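/- Let $n\in\{2,3\}$. For $1\le p\le\infty$ and $\sigma\in\mathbb R$ let $L^p_\sigma(\mathbb R^n)$ be the set of measurable $f$ with $(1+|x|^2)^{\sigma/2}f\in L^p(\mathbb R^n)$, and let $H^1_\sigma(\mathbb R^n)$ be the set of $f\in L^2_\sigma(\mathbb R^n)$ whose weak gradient lies in $L^2_\sigma(\mathbb R^n)$. Let $\vec W:\mathbb R^n\to\mathbb R^n$ and $V:\mathbb R^n\to\mathbb R$ satisfy $$\vec W\in L^\infty_{\delta}(\mathbb R^n),\qquad \nabla\vec W\in L^{p_1}_{\delta_1}(\mathbb R^n),\qquad V\in L^{p_2}_{\delta_2}(\mathbb R^n),$$ where $\nabla \vec W$ is the weak gradient, $3\le p_j\le\infty$ if $n=3$ and $2<p_j\le\infty$ if $n=2$ ($j=1,2$), and each weight exceeds $\frac{n+1}{2}-\frac np$ for the exponent $p$ of its own space: $\delta>\frac{n+1}{2}$ and $\delta_j>\frac{n+1}{2}-\frac{n}{p_j}$. For $k\in\mathbb R\setminus\{0\}$ let $$G_k^+(r)=\frac i4\Big(\frac{|k|}{2\pi r}\Big)^{\frac{n-2}{2}}H^{(1)}_{\frac{n-2}{2}}(|k|r),\qquad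 r>0,$$ where $H^{(1)}_\nu$ is the Hankel function of the first kind, be the kernel of $(-\Delta-k^2-i0)^{-1}$, and define $$L_kf(x)=\int_{\mathbb R^n}G_k^+(|x-y|)\Big(i\,\nabla\cdot(\vec Wf)(y)+i\,\vec W(y)\cdot\nabla f(y)-\big(|\vec W(y)|^2+V(y)\big)f(y)\Big)\,dy,$$ with weak derivatives. Then there is $\delta_0>\frac12$ such that for every real $k\neq0$: (a) for every $\theta\in\mathbb S^{n-1}$ and $u_0(x)=e^{ik(x,\theta)}$, the function $\tilde u_0=L_ku_0$ is well defined and belongs to $H^1_{-\delta_0}(\mathbb R^n)$; (b) for every $f\in H^1_{-\delta_0}(\mathbb R^n)$, the function $L_kf$ is well defined and belongs to $H^1_{-\delta_0}(\mathbb R^n)$. Here "well defined" means that the weak derivatives $\partial_j f$ and $\partial_j(W_jf)$ (respectively those for $u_0$) exist as locally integrable functions and that the integral converges absolutely for almost every $x$. -/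

import Mathlib

open MeasureTheory
open scoped ContDiff

noncomputable section

namespace MagneticScattering

/-- Euclidean space `ℝⁿ`. -/
abbrev E (n : ℕ) : Type := EuclideanSpace ℝ (Fin n)

/-- The weighted Lebesgue space `L^p_σ(ℝⁿ)`: `(1 + |x|²)^{σ/2} f` belongs to `L^p(ℝⁿ)`. -/
def MemWLp {n : ℕ} {F : Type*} [NormedAddCommGroup F] [NormedSpace ℝ F]
    (p : ENNReal) (σ : ℝ) (f : E n → F) : Prop :=
  MemLp (fun x => ((1 + ‖x‖ ^ 2) ^ (σ / 2) : ℝ) • f x) p volume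

/-- `g` is the weak (distributional) partial derivative `∂f/∂xᵢ`. -/
def HasWeakPartial {n : ℕ} {F : Type*} [NormedAddCommGroup F] [NormedSpace ℝ F]
    (i : Fin n) (f g : E n → F) : Prop :=
  LocallyIntegrable f volume ∧ LocallyIntegrable g volume ∧
    ∀ φ : E n → ℝ, ContDiff ℝ ∞ φ → HasCompactSupport φ →
      ∫ x, (fderiv ℝ φ x (EuclideanSpace.single i 1)) • f x = - ∫ x, φ x • g x

open Classical in
/-- The weak partial derivative `∂f/∂xᵢ` as a function (unique up to null sets); it is the zero
function if there is no locally integrable weak derivative. -/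
def weakPartial {n : ℕ} {F : Type*} [NormedAddCommGroup F] [NormedSpace ℝ F]
    (i : Fin n) (f : E n → F) : E n → F :=
  if h : ∃ g, HasWeakPartial i f g then h.choose else 0

/-- The weak gradient of `f` exists and belongs to `L^p_σ(ℝⁿ)` (componentwise). -/
def WeakGradMemWLp {n : ℕ} {F : Type*} [NormedAddCommGroup F] [NormedSpace ℝ F]
    (p : ENNReal) (σ : ℝ) (f : E n → F) : Prop :=
  ∀ i : Fin n, ∃ g : E n → F, HasWeakPartial i f g ∧ MemWLp p σ g

/-- The weighted Sobolev space `H^1_σ(ℝⁿ)`: `f` and its weak gradient belong to `L²_σ(ℝⁿ)`. -/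
def MemH1 {n : ℕ} (σ : ℝ) (f : E n → ℂ) : Prop :=
  MemWLp 2 σ f ∧ WeakGradMemWLp 2 σ f

/-- The range of Lebesgue exponents: `3 ≤ p ≤ ∞` if `n = 3`, and `2 < p ≤ ∞` if `n = 2`. -/
def ExponentOK (n : ℕ) (p : ENNReal) : Prop :=
  (n = 3 ∧ 3 ≤ p) ∨ (n = 2 ∧ 2 < p)

/-- The lower bound `(n + 1)/2 - n/p` for the weight of `L^p_δ(ℝⁿ)`, with `n/∞ = 0`. -/
def weightBound (n : ℕ) (p : ENNReal) : ℝ :=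
  ((n : ℝ) + 1) / 2 - (n : ℝ) * (p⁻¹).toReal

/-- The Hankel function `H_ν^{(1)}(z)` of the first kind for `ν > -1/2` and `z > 0`, in Hankel's
integral form
`H_ν^{(1)}(z) = (2/(π z))^{1/2} e^{i(z - νπ/2 - π/4)} / Γ(ν + 1/2) ·
  ∫₀^∞ e^{-u} u^{ν - 1/2} (1 + i u/(2z))^{ν - 1/2} du` (principal power, real part `1`). -/
def hankel1 (ν z : ℝ) : ℂ :=
  (Real.sqrt (2 / (Real.pi * z)) : ℂ)
    * Complex.exp (Complex.I * ((z - ν * Real.pi / 2 - Real.pi / 4 : ℝ) : ℂ))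
    / (Real.Gamma (ν + 1 / 2) : ℂ)
    * ∫ u in Set.Ioi (0 : ℝ), ((Real.exp (-u) * u ^ (ν - 1 / 2) : ℝ) : ℂ)
        * (1 + Complex.I * ((u / (2 * z) : ℝ) : ℂ)) ^ ((ν - 1 / 2 : ℝ) : ℂ)

/-- The outgoing Green function
`G_κ^+(r) = (i/4) (κ/(2π r))^{(n-2)/2} H^{(1)}_{(n-2)/2}(κ r)`, for `κ > 0` and `r > 0`: the
kernel of `(-Δ - κ² - i0)^{-1}` on `ℝⁿ` as a function of `r = |x - y|`. -/
def greenPlus (n : ℕ) (κ r : ℝ) : ℂ :=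
  Complex.I / 4 * (((κ / (2 * Real.pi * r)) ^ (((n : ℝ) - 2) / 2) : ℝ) : ℂ)
    * hankel1 (((n : ℝ) - 2) / 2) (κ * r)

/-- The function `i ∇·(W f) + i W·∇f - (|W|² + V) f`, with weak derivatives. -/
def source {n : ℕ} (W : E n → E n) (V : E n → ℝ) (f : E n → ℂ) (y : E n) : ℂ :=
  Complex.I * ∑ i, weakPartial i (fun x => (W x i : ℂ) * f x) y
    + Complex.I * ∑ i, (W y i : ℂ) * weakPartial i f y
    - ((‖W y‖ ^ 2 + V y : ℝ) : ℂ) * f y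

/-- The integral operator
`L_k f(x) = ∫ G_k^+(|x-y|) (i ∇·(W f) + i W·∇f - (|W|² + V) f)(y) dy`. The kernel is that of
`(-Δ - k² - i0)^{-1}`, so it depends on `k ≠ 0` through `|k|` only. -/
def Lk {n : ℕ} (k : ℝ) (W : E n → E n) (V : E n → ℝ) (f : E n → ℂ) (x : E n) : ℂ :=
  ∫ y, greenPlus n |k| ‖x - y‖ * source W V f y

/-- `L_k f` is well defined: all weak derivatives in it exist as locally integrable functions, and
the integral converges absolutely for almost every `x`. -/
def LkDefined {n : ℕ} (k : ℝ) (W : E n → E n) (V : E n → ℝ) (f : E n → ℂ) : Prop :=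
  (∀ i, ∃ g, HasWeakPartial i (fun x => (W x i : ℂ) * f x) g) ∧
  (∀ i, ∃ g, HasWeakPartial i f g) ∧
  ∀ᵐ x : E n, Integrable (fun y => greenPlus n |k| ‖x - y‖ * source W V f y) volume

/-- The incident plane wave `u₀(x) = e^{i k (x, θ)}`. -/
def planeWave {n : ℕ} (k : ℝ) (θ x : E n) : ℂ :=
  Complex.exp (Complex.I * ((k * inner ℝ x θ : ℝ) : ℂ))

end MagneticScattering

end

/-!
Let `ε > 0` be smaller than the gaps `δ - (n + 1)/2` and `δⱼ - ((n + 1)/2 - n/pⱼ)`; then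
`δ₀ = n/2 + ε` works. Since `δ₀ > n/2`, plane waves belong to `H¹_{-δ₀}`, and (a) is a case of (b).

For `f ∈ H¹_{-δ₀}`, Hölder's inequality and the Sobolev embedding put the source
`i∇·(Wf) + iW·∇f - (|W|² + V)f` into `L¹_{-α} ∩ L²_{-δ₀}`, where `α = (n - 1)/2`.

For `n = 2, 3` Hankel's integral bounds `G_k^+(r)` and its derivative by a multiple of
`r^{-α} + r^{-α-1}`. The part of such a kernel near the origin is integrable, and convolution with
it preserves `L²_{-δ₀}` by Schur's test. The part at infinity maps `L¹_{-α}` to `L²_{-δ₀}` because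
`∫ ⟨x - y⟩^{-2α} ⟨x⟩^{-2δ₀} dx` is at most a multiple of `⟨y⟩^{-2α}`. Hence `L_k f` and the
convolution of the source with the gradient of the kernel, which is its weak gradient, lie in
`L²_{-δ₀}`.
-/

noncomputable section

namespace MagneticScattering

section OutgoingProfile

/-- The size `r^{-α} + r^{-α-1}` of an outgoing wave of decay rate `α` and of its derivative. -/
def outgoingMajorant (α r : ℝ) : ℝ := r ^ (-α) + r ^ (-α - 1)

lemma outgoingMajorant_anti {α r s : ℝ} (hα : 0 ≤ α) (hr : 0 < r) (hrs : r ≤ s) :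
    outgoingMajorant α s ≤ outgoingMajorant α r :=
  add_le_add (Real.rpow_le_rpow_of_nonpos hr hrs (by linarith))
    (Real.rpow_le_rpow_of_nonpos hr hrs (by linarith))

/-- The radial profile `G` of a convolution kernel is `C¹` on `(0, ∞)`, and `G` and `G'` are
dominated by `C (r^{-α} + r^{-α-1})`. -/
structure IsOutgoingProfile (α C : ℝ) (G : ℝ → ℂ) : Prop where
  contDiffOn : ContDiffOn ℝ 1 G (Set.Ioi 0)
  norm_le : ∀ r, 0 < r → ‖G r‖ ≤ C * outgoingMajorant α r
  norm_deriv_le : ∀ r, 0 < r → ‖deriv G r‖ ≤ C * outgoingMajorant α r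

/-- The outgoing wave `r^{-α} e^{iκr}`. -/
def outgoingWave (α κ r : ℝ) : ℂ :=
  ((r ^ (-α) : ℝ) : ℂ) * Complex.exp (Complex.I * ((κ * r : ℝ) : ℂ))

variable {α κ r : ℝ}

lemma norm_exp_I_mul_ofReal (t : ℝ) : ‖Complex.exp (Complex.I * (t : ℂ))‖ = 1 := by
  rw [mul_comm, Complex.norm_exp_ofReal_mul_I]

lemma norm_outgoingWave (hr : 0 ≤ r) : ‖outgoingWave α κ r‖ = r ^ (-α) := by
  rw [outgoingWave, norm_mul, norm_exp_I_mul_ofReal, mul_one, Complex.norm_real,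
    Real.norm_of_nonneg (by positivity)]

lemma contDiffOn_outgoingWave : ContDiffOn ℝ 1 (outgoingWave α κ) (Set.Ioi 0) := by
  have hpow : ContDiffOn ℝ 1 (fun r : ℝ => r ^ (-α)) (Set.Ioi 0) :=
    contDiffOn_id.rpow_const_of_ne fun r hr => ne_of_gt hr
  have hexp : ContDiff ℝ 1 fun r : ℝ => Complex.exp (Complex.I * ((κ * r : ℝ) : ℂ)) :=
    (contDiff_const.mul (Complex.ofRealCLM.contDiff.comp (contDiff_const.mul contDiff_id))).cexp
  exact (Complex.ofRealCLM.contDiff.comp_contDiffOn hpow).mul hexp.contDiffOn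

lemma hasDerivAt_outgoingWave (hr : 0 < r) :
    HasDerivAt (outgoingWave α κ)
      ((Complex.I * κ - ((α * r⁻¹ : ℝ) : ℂ)) * outgoingWave α κ r) r := by
  have hpow : HasDerivAt (fun r : ℝ => ((r ^ (-α) : ℝ) : ℂ)) ((-α * r ^ (-α - 1) : ℝ) : ℂ) r :=
    (Real.hasDerivAt_rpow_const (Or.inl hr.ne')).ofReal_comp
  have hphase : HasDerivAt (fun r : ℝ => Complex.I * ((κ * r : ℝ) : ℂ)) (Complex.I * κ) r := by
    simpa using ((hasDerivAt_id r).const_mul κ).ofReal_comp.const_mul Complex.I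
  refine (hpow.mul hphase.cexp).congr_deriv ?_
  rw [outgoingWave, Real.rpow_sub_one hr.ne', div_eq_mul_inv]
  push_cast
  ring

lemma norm_deriv_outgoingWave_le (hα : 0 ≤ α) (hκ : 0 ≤ κ) (hr : 0 < r) :
    ‖deriv (outgoingWave α κ) r‖ ≤ κ * r ^ (-α) + α * r ^ (-α - 1) := by
  rw [(hasDerivAt_outgoingWave hr).deriv, norm_mul, norm_outgoingWave hr.le]
  calc ‖Complex.I * κ - ((α * r⁻¹ : ℝ) : ℂ)‖ * r ^ (-α)
      ≤ (κ + α * r⁻¹) * r ^ (-α) := by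
        gcongr
        refine (norm_sub_le _ _).trans (le_of_eq ?_)
        rw [norm_mul, Complex.norm_I, Complex.norm_real, Complex.norm_real,
          Real.norm_of_nonneg hκ, Real.norm_of_nonneg (by positivity), one_mul]
    _ = κ * r ^ (-α) + α * r ^ (-α - 1) := by
        rw [Real.rpow_sub_one hr.ne']
        ring

lemma norm_outgoingWave_mul_le {M : ℝ} (hα : 0 ≤ α) (hκ : 0 ≤ κ) (hr : 0 < r) {J : ℝ → ℂ}
    (hJM : ‖J r‖ ≤ M) :
    ‖outgoingWave α κ r * J r‖ ≤ M * (1 + α + κ) * outgoingMajorant α r := by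
  have hM : 0 ≤ M := (norm_nonneg _).trans hJM
  have hpos : 0 < r ^ (-α) ∧ 0 < r ^ (-α - 1) := by constructor <;> positivity
  rw [norm_mul, norm_outgoingWave hr.le, outgoingMajorant]
  calc r ^ (-α) * ‖J r‖ ≤ r ^ (-α) * M := by gcongr
    _ = M * 1 * r ^ (-α) := by ring
    _ ≤ M * (1 + α + κ) * (r ^ (-α) + r ^ (-α - 1)) := by gcongr <;> linarith

lemma norm_deriv_outgoingWave_mul_le {M : ℝ} (hα : 0 ≤ α) (hκ : 0 ≤ κ) (hr : 0 < r) {J : ℝ → ℂ}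
    (hJ : DifferentiableAt ℝ J r) (hJM : ‖J r‖ ≤ M) (hJM' : ‖deriv J r‖ ≤ M * r⁻¹) :
    ‖deriv (fun r => outgoingWave α κ r * J r) r‖ ≤ M * (1 + α + κ) * outgoingMajorant α r := by
  have hM : 0 ≤ M := (norm_nonneg _).trans hJM
  rw [deriv_fun_mul (hasDerivAt_outgoingWave hr).differentiableAt hJ, outgoingMajorant]
  calc ‖deriv (outgoingWave α κ) r * J r + outgoingWave α κ r * deriv J r‖
      ≤ (κ * r ^ (-α) + α * r ^ (-α - 1)) * M + r ^ (-α) * (M * r⁻¹) := by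
        refine norm_add_le_of_le ?_ ?_ <;> rw [norm_mul]
        · gcongr
          exact norm_deriv_outgoingWave_le hα hκ hr
        · rw [norm_outgoingWave hr.le]
          gcongr
    _ = M * (κ * r ^ (-α) + (1 + α) * r ^ (-α - 1)) := by
        rw [Real.rpow_sub_one hr.ne']
        ring
    _ ≤ M * ((1 + α + κ) * r ^ (-α) + (1 + α + κ) * r ^ (-α - 1)) := by
        gcongr M * (?_ * _ + ?_ * _) <;> linarith
    _ = M * (1 + α + κ) * (r ^ (-α) + r ^ (-α - 1)) := by ring

lemma isOutgoingProfile_of_amplitude {M : ℝ} (hα : 0 ≤ α) (hκ : 0 ≤ κ) (c : ℂ) {G J : ℝ → ℂ}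
    (hG : ∀ r, 0 < r → G r = c * (outgoingWave α κ r * J r))
    (hJ : ContDiffOn ℝ 1 J (Set.Ioi 0)) (hJM : ∀ r, 0 < r → ‖J r‖ ≤ M)
    (hJM' : ∀ r, 0 < r → ‖deriv J r‖ ≤ M * r⁻¹) :
    IsOutgoingProfile α (‖c‖ * (M * (1 + α + κ))) G := by
  refine ⟨(contDiffOn_const.mul (contDiffOn_outgoingWave.mul hJ)).congr hG,
    fun r hr => ?_, fun r hr => ?_⟩
  · rw [hG r hr, norm_mul, mul_assoc]
    gcongr
    exact norm_outgoingWave_mul_le hα hκ hr (hJM r hr)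
  · have hJr : DifferentiableAt ℝ J r :=
      (hJ.differentiableOn one_ne_zero).differentiableAt (Ioi_mem_nhds hr)
    have hGr : G =ᶠ[nhds r] fun r => c * (outgoingWave α κ r * J r) := (lt_mem_nhds hr).mono hG
    rw [hGr.deriv_eq, deriv_const_mul_field, norm_mul, mul_assoc]
    gcongr
    exact norm_deriv_outgoingWave_mul_le hα hκ hr hJr (hJM r hr) (hJM' r hr)

end OutgoingProfile

section Hankel

variable {a z u : ℝ}

lemma one_le_norm_one_add_I_mul (t : ℝ) : 1 ≤ ‖1 + Complex.I * (t : ℂ)‖ := by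
  simpa using Complex.abs_re_le_norm (1 + Complex.I * (t : ℂ))

lemma abs_le_norm_one_add_I_mul (t : ℝ) : |t| ≤ ‖1 + Complex.I * (t : ℂ)‖ := by
  simpa using Complex.abs_im_le_norm (1 + Complex.I * (t : ℂ))

lemma one_add_I_mul_mem_slitPlane (t : ℝ) : 1 + Complex.I * (t : ℂ) ∈ Complex.slitPlane := by
  left
  simp

/-- The integrand `e^{-u} u^a (1 + iu/(2z))^a` of Hankel's integral of order `ν = a + 1/2`. -/
def hankelIntegrand (a z u : ℝ) : ℂ :=
  ((Real.exp (-u) * u ^ a : ℝ) : ℂ) * (1 + Complex.I * ((u / (2 * z) : ℝ) : ℂ)) ^ (a : ℂ)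

/-- The partial derivative of `hankelIntegrand` in `z`. -/
def hankelIntegrandDeriv (a z u : ℝ) : ℂ :=
  ((Real.exp (-u) * u ^ a : ℝ) : ℂ)
    * (a * (1 + Complex.I * ((u / (2 * z) : ℝ) : ℂ)) ^ ((a - 1 : ℝ) : ℂ)
      * (Complex.I * ((-(u / (2 * z ^ 2)) : ℝ) : ℂ)))

/-- The integral factor of the Hankel function of order `ν = a + 1/2`; it is the amplitude that
modulates the outgoing wave `z^{-1/2} e^{iz}`. -/
def hankelAmplitude (a z : ℝ) : ℂ := ∫ u in Set.Ioi (0 : ℝ), hankelIntegrand a z u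

lemma integrableOn_exp_neg_mul_rpow (ha : -1 < a) :
    IntegrableOn (fun u : ℝ => Real.exp (-u) * u ^ a) (Set.Ioi 0) := by
  simpa using Real.GammaIntegral_convergent (s := a + 1) (by linarith)

lemma integral_exp_neg_mul_rpow (ha : -1 < a) :
    ∫ u in Set.Ioi (0 : ℝ), Real.exp (-u) * u ^ a = Real.Gamma (a + 1) := by
  rw [Real.Gamma_eq_integral (by linarith)]
  simp

lemma norm_hankelIntegrand_le (ha : a ≤ 0) (hu : 0 < u) :
    ‖hankelIntegrand a z u‖ ≤ Real.exp (-u) * u ^ a := by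
  rw [hankelIntegrand, norm_mul, Complex.norm_real, Real.norm_of_nonneg (by positivity),
    Complex.norm_cpow_real]
  exact mul_le_of_le_one_right (by positivity)
    (Real.rpow_le_one_of_one_le_of_nonpos (one_le_norm_one_add_I_mul _) ha)

lemma norm_one_add_I_mul_rpow_le (ha : a ≤ 0) {t : ℝ} (ht : 0 < t) :
    ‖1 + Complex.I * (t : ℂ)‖ ^ (a - 1) ≤ t⁻¹ := by
  calc ‖1 + Complex.I * (t : ℂ)‖ ^ (a - 1)
      ≤ ‖1 + Complex.I * (t : ℂ)‖ ^ (-1 : ℝ) :=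
        Real.rpow_le_rpow_of_exponent_le (one_le_norm_one_add_I_mul t) (by linarith)
    _ ≤ t ^ (-1 : ℝ) :=
        Real.rpow_le_rpow_of_nonpos ht ((le_abs_self t).trans (abs_le_norm_one_add_I_mul t))
          (by norm_num)
    _ = t⁻¹ := Real.rpow_neg_one t

lemma norm_hankelIntegrandDeriv_le (ha : -1 ≤ a) (ha' : a ≤ 0) (hz : 0 < z) (hu : 0 < u) :
    ‖hankelIntegrandDeriv a z u‖ ≤ Real.exp (-u) * u ^ a * z⁻¹ := by
  have habs : |a| ≤ 1 := abs_le.2 ⟨ha, by linarith⟩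
  rw [hankelIntegrandDeriv, norm_mul, Complex.norm_real, Real.norm_of_nonneg (by positivity)]
  gcongr
  rw [norm_mul, norm_mul, norm_mul, Complex.norm_cpow_real, Complex.norm_I, Complex.norm_real,
    Complex.norm_real, norm_neg, Real.norm_eq_abs, Real.norm_of_nonneg (by positivity)]
  calc |a| * ‖1 + Complex.I * ((u / (2 * z) : ℝ) : ℂ)‖ ^ (a - 1) * (1 * (u / (2 * z ^ 2)))
      ≤ 1 * (u / (2 * z))⁻¹ * (1 * (u / (2 * z ^ 2))) := by
        gcongr
        exact norm_one_add_I_mul_rpow_le ha' (by positivity)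
    _ = z⁻¹ := by field_simp

lemma hasDerivAt_hankelIntegrand (a : ℝ) (hz : 0 < z) (u : ℝ) :
    HasDerivAt (fun z => hankelIntegrand a z u) (hankelIntegrandDeriv a z u) z := by
  have hquot : HasDerivAt (fun z : ℝ => u / (2 * z)) (-(u / (2 * z ^ 2))) z := by
    refine ((((hasDerivAt_id z).const_mul 2).fun_inv (by simpa using hz.ne')).const_mul
      u).congr_deriv ?_
    simp only [id_eq]
    field_simp
  have hbase : HasDerivAt (fun z : ℝ => 1 + Complex.I * ((u / (2 * z) : ℝ) : ℂ))
      (Complex.I * ((-(u / (2 * z ^ 2)) : ℝ) : ℂ)) z :=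
    (hquot.ofReal_comp.const_mul Complex.I).const_add 1
  refine (((Complex.hasStrictDerivAt_cpow_const
    (one_add_I_mul_mem_slitPlane _)).hasDerivAt.comp z hbase).const_mul _).congr_deriv ?_
  rw [hankelIntegrandDeriv]
  push_cast
  rfl

lemma continuousOn_one_add_I_mul_cpow {X : Type*} [TopologicalSpace X] {f : X → ℝ} {s : Set X}
    (hf : ContinuousOn f s) (b : ℂ) :
    ContinuousOn (fun x => (1 + Complex.I * (f x : ℂ)) ^ b) s :=
  ContinuousOn.cpow_const (by fun_prop) fun x _ => one_add_I_mul_mem_slitPlane (f x)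

lemma continuousOn_rpow_const_Ioi (a : ℝ) : ContinuousOn (fun u : ℝ => u ^ a) (Set.Ioi 0) :=
  continuousOn_id.rpow_const fun _ hu => Or.inl (ne_of_gt hu)

lemma aestronglyMeasurable_hankelIntegrand (a z : ℝ) :
    AEStronglyMeasurable (hankelIntegrand a z) (volume.restrict (Set.Ioi 0)) := by
  have hpow := continuousOn_rpow_const_Ioi a
  have hcpow := continuousOn_one_add_I_mul_cpow (f := fun u : ℝ => u / (2 * z)) (s := Set.Ioi 0)
    (by fun_prop) a
  refine ContinuousOn.aestronglyMeasurable ?_ measurableSet_Ioi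
  unfold hankelIntegrand
  fun_prop

lemma aestronglyMeasurable_hankelIntegrandDeriv (a z : ℝ) :
    AEStronglyMeasurable (hankelIntegrandDeriv a z) (volume.restrict (Set.Ioi 0)) := by
  have hpow := continuousOn_rpow_const_Ioi a
  have hcpow := continuousOn_one_add_I_mul_cpow (f := fun u : ℝ => u / (2 * z)) (s := Set.Ioi 0)
    (by fun_prop) ((a - 1 : ℝ) : ℂ)
  refine ContinuousOn.aestronglyMeasurable ?_ measurableSet_Ioi
  unfold hankelIntegrandDeriv
  fun_prop

lemma continuousOn_hankelIntegrandDeriv (a u : ℝ) :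
    ContinuousOn (fun z => hankelIntegrandDeriv a z u) (Set.Ioi 0) := by
  have hquot : ContinuousOn (fun z : ℝ => u / (2 * z)) (Set.Ioi 0) :=
    continuousOn_const.div (by fun_prop) fun z (hz : 0 < z) => by positivity
  have hquot' : ContinuousOn (fun z : ℝ => -(u / (2 * z ^ 2))) (Set.Ioi 0) :=
    (continuousOn_const.div (by fun_prop) fun z (hz : 0 < z) => by positivity).neg
  have hcpow := continuousOn_one_add_I_mul_cpow hquot ((a - 1 : ℝ) : ℂ)
  unfold hankelIntegrandDeriv
  fun_prop

lemma hasDerivAt_hankelAmplitude (ha : -1 < a) (ha' : a ≤ 0) (hz : 0 < z) :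
    HasDerivAt (hankelAmplitude a) (∫ u in Set.Ioi (0 : ℝ), hankelIntegrandDeriv a z u) z := by
  refine (hasDerivAt_integral_of_dominated_loc_of_deriv_le (s := Set.Ioi (z / 2))
    (bound := fun u => Real.exp (-u) * u ^ a * (z / 2)⁻¹) (Ioi_mem_nhds (half_lt_self hz))
    (.of_forall (aestronglyMeasurable_hankelIntegrand a)) ?_
    (aestronglyMeasurable_hankelIntegrandDeriv a z) ?_
    ((integrableOn_exp_neg_mul_rpow ha).mul_const _) ?_).2
  · exact (integrableOn_exp_neg_mul_rpow ha).mono' (aestronglyMeasurable_hankelIntegrand a z)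
      ((ae_restrict_mem measurableSet_Ioi).mono fun u hu => norm_hankelIntegrand_le ha' hu)
  · filter_upwards [ae_restrict_mem measurableSet_Ioi] with u (hu : 0 < u) y (hy : z / 2 < y)
    refine (norm_hankelIntegrandDeriv_le ha.le ha' ((half_pos hz).trans hy) hu).trans ?_
    gcongr
  · exact .of_forall fun u y hy => hasDerivAt_hankelIntegrand a ((half_pos hz).trans hy) u

lemma continuousOn_integral_hankelIntegrandDeriv (ha : -1 < a) (ha' : a ≤ 0) :
    ContinuousOn (fun z => ∫ u in Set.Ioi (0 : ℝ), hankelIntegrandDeriv a z u) (Set.Ioi 0) := by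
  intro z (hz : 0 < z)
  refine (continuousAt_of_dominated (bound := fun u => Real.exp (-u) * u ^ a * (z / 2)⁻¹)
    (.of_forall (aestronglyMeasurable_hankelIntegrandDeriv a)) ?_
    ((integrableOn_exp_neg_mul_rpow ha).mul_const _)
    (.of_forall fun u => (continuousOn_hankelIntegrandDeriv a u).continuousAt
      (Ioi_mem_nhds hz))).continuousWithinAt
  filter_upwards [lt_mem_nhds (half_lt_self hz)] with y hy
  filter_upwards [ae_restrict_mem measurableSet_Ioi] with u hu
  refine (norm_hankelIntegrandDeriv_le ha.le ha' ((half_pos hz).trans hy) hu).trans ?_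
  have : 0 < u := hu
  gcongr

lemma contDiffOn_hankelAmplitude (ha : -1 < a) (ha' : a ≤ 0) :
    ContDiffOn ℝ 1 (hankelAmplitude a) (Set.Ioi 0) := by
  rw [← zero_add (1 : WithTop ℕ∞), contDiffOn_succ_iff_deriv_of_isOpen isOpen_Ioi]
  refine ⟨fun z hz =>
    (hasDerivAt_hankelAmplitude ha ha' hz).differentiableAt.differentiableWithinAt, by simp, ?_⟩
  exact contDiffOn_zero.2 <| (continuousOn_integral_hankelIntegrandDeriv ha ha').congr fun z hz =>
    (hasDerivAt_hankelAmplitude ha ha' hz).deriv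

lemma norm_hankelAmplitude_le (ha : -1 < a) (ha' : a ≤ 0) (z : ℝ) :
    ‖hankelAmplitude a z‖ ≤ Real.Gamma (a + 1) := by
  rw [← integral_exp_neg_mul_rpow ha]
  exact norm_integral_le_of_norm_le (integrableOn_exp_neg_mul_rpow ha)
    ((ae_restrict_mem measurableSet_Ioi).mono fun u hu => norm_hankelIntegrand_le ha' hu)

lemma norm_deriv_hankelAmplitude_le (ha : -1 < a) (ha' : a ≤ 0) (hz : 0 < z) :
    ‖deriv (hankelAmplitude a) z‖ ≤ Real.Gamma (a + 1) * z⁻¹ := by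
  rw [(hasDerivAt_hankelAmplitude ha ha' hz).deriv, ← integral_exp_neg_mul_rpow ha,
    ← integral_mul_const]
  exact norm_integral_le_of_norm_le ((integrableOn_exp_neg_mul_rpow ha).mul_const _)
    ((ae_restrict_mem measurableSet_Ioi).mono fun u hu =>
      norm_hankelIntegrandDeriv_le ha.le ha' hz hu)

end Hankel

section Green

lemma sqrt_two_div_pi_mul {κ r : ℝ} (hκ : 0 < κ) (hr : 0 < r) :
    Real.sqrt (2 / (Real.pi * (κ * r)))
      = Real.sqrt (2 / (Real.pi * κ)) * r ^ (-(1 / 2) : ℝ) := by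
  rw [Real.rpow_neg hr.le, ← Real.sqrt_eq_rpow, ← Real.sqrt_inv, ← Real.sqrt_mul (by positivity)]
  congr 1
  field_simp

/-- The constant factor of `greenPlus n κ r` once the outgoing wave `r^{-(n-1)/2} e^{iκr}` and the
Hankel amplitude are split off. -/
def greenConstant (n : ℕ) (κ : ℝ) : ℂ :=
  Complex.I / 4 * (((κ / (2 * Real.pi)) ^ (((n : ℝ) - 2) / 2) : ℝ) : ℂ)
    * (Real.sqrt (2 / (Real.pi * κ)) : ℂ)
    * Complex.exp (Complex.I
      * ((-(((n : ℝ) - 2) / 2 * Real.pi / 2 + Real.pi / 4) : ℝ) : ℂ))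
    / (Real.Gamma (((n : ℝ) - 2) / 2 + 1 / 2) : ℂ)

lemma greenPlus_eq_outgoingWave_mul (n : ℕ) {κ r : ℝ} (hκ : 0 < κ) (hr : 0 < r) :
    greenPlus n κ r = greenConstant n κ
      * (outgoingWave (((n : ℝ) - 1) / 2) κ r
        * hankelAmplitude (((n : ℝ) - 2) / 2 - 1 / 2) (κ * r)) := by
  have hpow : (κ / (2 * Real.pi * r)) ^ (((n : ℝ) - 2) / 2)
      = (κ / (2 * Real.pi)) ^ (((n : ℝ) - 2) / 2) * r ^ (-(((n : ℝ) - 2) / 2)) := by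
    rw [Real.rpow_neg hr.le, ← div_div, Real.div_rpow (by positivity) hr.le, div_eq_mul_inv]
  have hdecay : r ^ (-(((n : ℝ) - 1) / 2))
      = r ^ (-(((n : ℝ) - 2) / 2)) * r ^ (-(1 / 2) : ℝ) := by
    rw [← Real.rpow_add hr]
    ring_nf
  have hphase (s t : ℝ) : Complex.exp (Complex.I * ((s - t : ℝ) : ℂ))
      = Complex.exp (Complex.I * (s : ℂ)) * Complex.exp (Complex.I * ((-t : ℝ) : ℂ)) := by
    rw [← Complex.exp_add, ← mul_add, ← Complex.ofReal_add, sub_eq_add_neg]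
  have hhankel : hankel1 (((n : ℝ) - 2) / 2) (κ * r)
      = (Real.sqrt (2 / (Real.pi * (κ * r))) : ℂ)
        * Complex.exp (Complex.I
          * ((κ * r - ((n : ℝ) - 2) / 2 * Real.pi / 2 - Real.pi / 4 : ℝ) : ℂ))
        / (Real.Gamma (((n : ℝ) - 2) / 2 + 1 / 2) : ℂ)
        * hankelAmplitude (((n : ℝ) - 2) / 2 - 1 / 2) (κ * r) := rfl
  rw [greenPlus, hhankel, hpow, sqrt_two_div_pi_mul hκ hr, sub_sub, hphase, outgoingWave, hdecay,
    greenConstant, Complex.ofReal_mul, Complex.ofReal_mul, Complex.ofReal_mul (r ^ _)]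
  ring

-- The exponent `ν - 1/2 = (n - 3)/2` of Hankel's integral lies in `(-1, 0]` here, so that the
-- factor `(1 + iu/(2z))^{ν - 1/2}` is bounded by `1`.
lemma exists_isOutgoingProfile_greenPlus {n : ℕ} (hn : n = 2 ∨ n = 3) {κ : ℝ} (hκ : 0 < κ) :
    ∃ C, IsOutgoingProfile (((n : ℝ) - 1) / 2) C (greenPlus n κ) := by
  set a : ℝ := ((n : ℝ) - 2) / 2 - 1 / 2 with ha
  have ha₀ : -1 < a ∧ a ≤ 0 := by rcases hn with rfl | rfl <;> norm_num [ha]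
  have hα : 0 ≤ ((n : ℝ) - 1) / 2 := by linarith [ha₀.1]
  refine ⟨_, isOutgoingProfile_of_amplitude (M := Real.Gamma (a + 1)) hα hκ.le (greenConstant n κ)
    (fun r hr => greenPlus_eq_outgoingWave_mul n hκ hr) ?_
    (fun r _ => norm_hankelAmplitude_le ha₀.1 ha₀.2 (κ * r)) fun r hr => ?_⟩
  · exact (contDiffOn_hankelAmplitude ha₀.1 ha₀.2).comp (by fun_prop) fun r hr => mul_pos hκ hr
  · rw [deriv_comp_mul_left κ (hankelAmplitude a), norm_smul, Real.norm_of_nonneg hκ.le]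
    calc κ * ‖deriv (hankelAmplitude a) (κ * r)‖ ≤ κ * (Real.Gamma (a + 1) * (κ * r)⁻¹) := by
          gcongr
          exact norm_deriv_hankelAmplitude_le ha₀.1 ha₀.2 (mul_pos hκ hr)
      _ = Real.Gamma (a + 1) * r⁻¹ := by field_simp

end Green

section Bracket

variable {X : Type*} [SeminormedAddCommGroup X] {σ : ℝ}

/-- The Japanese bracket `⟨x⟩^σ = (1 + |x|²)^{σ/2}`, the weight of `MemWLp`. -/
def bracket (σ : ℝ) (x : X) : ℝ := (1 + ‖x‖ ^ 2) ^ (σ / 2)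

lemma one_add_norm_sq_pos (x : X) : 0 < 1 + ‖x‖ ^ 2 := by positivity

lemma bracket_pos (σ : ℝ) (x : X) : 0 < bracket σ x :=
  Real.rpow_pos_of_pos (one_add_norm_sq_pos x) _

lemma norm_bracket (σ : ℝ) (x : X) : ‖bracket σ x‖ = bracket σ x :=
  Real.norm_of_nonneg (bracket_pos σ x).le

lemma bracket_add (σ τ : ℝ) (x : X) : bracket (σ + τ) x = bracket σ x * bracket τ x := by
  rw [bracket, add_div, Real.rpow_add (one_add_norm_sq_pos x)]
  rfl

lemma bracket_zero (x : X) : bracket 0 x = 1 := by simp [bracket]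

lemma bracket_neg_mul (σ : ℝ) (x : X) : bracket (-σ) x * bracket σ x = 1 := by
  rw [← bracket_add, neg_add_cancel, bracket_zero]

lemma bracket_neg (σ : ℝ) (x : X) : bracket (-σ) x = (bracket σ x)⁻¹ :=
  eq_inv_of_mul_eq_one_left (bracket_neg_mul σ x)

lemma bracket_rpow (σ t : ℝ) (x : X) : bracket σ x ^ t = bracket (σ * t) x := by
  rw [bracket, bracket, ← Real.rpow_mul (one_add_norm_sq_pos x).le, div_mul_eq_mul_div]

lemma bracket_sq (σ : ℝ) (x : X) : bracket σ x ^ 2 = bracket (2 * σ) x := by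
  rw [sq, ← bracket_add, two_mul]

lemma bracket_mono {τ : ℝ} (h : σ ≤ τ) (x : X) : bracket σ x ≤ bracket τ x :=
  Real.rpow_le_rpow_of_exponent_le (le_add_of_nonneg_right (sq_nonneg _)) (by linarith)

lemma bracket_le_bracket {x y : X} (hσ : 0 ≤ σ) (h : ‖x‖ ≤ ‖y‖) : bracket σ x ≤ bracket σ y := by
  unfold bracket
  gcongr

lemma bracket_le_of_one_add_norm_sq_le {c : ℝ} {x y : X} (hσ : 0 ≤ σ) (hc : 0 ≤ c)
    (h : 1 + ‖x‖ ^ 2 ≤ c * (1 + ‖y‖ ^ 2)) : bracket σ x ≤ c ^ (σ / 2) * bracket σ y := by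
  unfold bracket
  rw [← Real.mul_rpow hc (one_add_norm_sq_pos y).le]
  gcongr

lemma bracket_neg_le_of_norm_sub_le_one (hσ : 0 ≤ σ) {x y : X} (h : ‖x - y‖ ≤ 1) :
    bracket (-σ) x ≤ 3 ^ (σ / 2) * bracket (-σ) y := by
  have hnorm : ‖y‖ ≤ ‖x‖ + 1 := (norm_le_norm_add_norm_sub x y).trans (by gcongr)
  have hle : bracket σ y ≤ 3 ^ (σ / 2) * bracket σ x :=
    bracket_le_of_one_add_norm_sq_le hσ (by norm_num)
      (by nlinarith [norm_nonneg x, norm_nonneg y, sq_nonneg (‖x‖ - 1)])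
  rw [bracket_neg, bracket_neg, inv_eq_one_div, ← div_eq_mul_inv,
    div_le_div_iff₀ (bracket_pos σ x) (bracket_pos σ y), one_mul]
  exact hle

lemma bracket_le_of_norm_le_two_mul {x y : X} (hσ : 0 ≤ σ) (h : ‖x‖ ≤ 2 * ‖y‖) :
    bracket σ x ≤ 4 ^ (σ / 2) * bracket σ y :=
  bracket_le_of_one_add_norm_sq_le hσ (by norm_num) (by nlinarith [norm_nonneg x])

lemma bracket_le_add (hσ : 0 ≤ σ) (x y : X) :
    bracket σ y ≤ 4 ^ (σ / 2) * (bracket σ x + bracket σ (x - y)) := by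
  have htri := norm_le_norm_add_norm_sub x y
  have hx := bracket_pos σ x
  have hxy := bracket_pos σ (x - y)
  rcases le_total ‖x‖ ‖x - y‖ with h | h
  · refine (bracket_le_of_norm_le_two_mul (y := x - y) hσ (by linarith)).trans ?_
    gcongr
    linarith
  · refine (bracket_le_of_norm_le_two_mul (y := x) hσ (by linarith)).trans ?_
    gcongr
    linarith

lemma bracket_neg_mul_bracket_neg_le {a b : ℝ} (ha : 0 ≤ a) (hb : 0 ≤ b) (x y : X) :
    bracket (-a) x * bracket (-b) y ≤ bracket (-(a + b)) x + bracket (-(a + b)) y := by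
  have hanti {c : ℝ} (hc : 0 ≤ c) {u v : X} (h : ‖u‖ ≤ ‖v‖) : bracket (-c) v ≤ bracket (-c) u := by
    rw [bracket_neg, bracket_neg]
    exact inv_anti₀ (bracket_pos c u) (bracket_le_bracket hc h)
  have hpos (c : ℝ) (u : X) := bracket_pos (-c) u
  rw [neg_add, bracket_add, bracket_add]
  rcases le_total ‖x‖ ‖y‖ with h | h
  · calc bracket (-a) x * bracket (-b) y ≤ bracket (-a) x * bracket (-b) x :=
          mul_le_mul_of_nonneg_left (hanti hb h) (hpos a x).le
      _ ≤ _ := le_add_of_nonneg_right (mul_pos (hpos a y) (hpos b y)).le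
  · calc bracket (-a) x * bracket (-b) y ≤ bracket (-a) y * bracket (-b) y :=
          mul_le_mul_of_nonneg_right (hanti ha h) (hpos b y).le
      _ ≤ _ := le_add_of_nonneg_left (mul_pos (hpos a x) (hpos b x)).le

lemma continuous_bracket (σ : ℝ) : Continuous (bracket σ : X → ℝ) :=
  Continuous.rpow_const (by fun_prop) fun x => Or.inl (one_add_norm_sq_pos x).ne'

end Bracket

section BracketCalculus

variable {X : Type*} [NormedAddCommGroup X] [InnerProductSpace ℝ X]

lemma contDiff_bracket (σ : ℝ) : ContDiff ℝ ∞ (bracket σ : X → ℝ) :=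
  ContDiff.rpow_const_of_ne (contDiff_const.add (contDiff_norm_sq ℝ))
    fun x => (one_add_norm_sq_pos x).ne'

lemma hasFDerivAt_bracket (σ : ℝ) (x : X) :
    HasFDerivAt (bracket σ : X → ℝ) ((σ * bracket (σ - 2) x) • innerSL ℝ x) x := by
  have hsq : HasFDerivAt (fun x : X => 1 + ‖x‖ ^ 2) (2 • innerSL ℝ x) x :=
    (hasStrictFDerivAt_norm_sq x).hasFDerivAt.const_add 1
  refine (hsq.rpow_const (p := σ / 2) (Or.inl (one_add_norm_sq_pos x).ne')).congr_fderiv ?_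
  rw [two_nsmul, smul_add, ← add_smul, bracket]
  congr 1
  rw [← add_mul, add_halves, sub_div, div_self two_ne_zero]

lemma abs_fderiv_bracket_le (σ : ℝ) (x v : X) :
    |fderiv ℝ (bracket σ) x v| ≤ |σ| * bracket σ x * ‖v‖ := by
  have hb := bracket_pos (σ - 2) x
  have hsplit : bracket σ x = bracket (σ - 2) x * (1 + ‖x‖ ^ 2) := by
    have htwo : bracket 2 x = 1 + ‖x‖ ^ 2 := by rw [bracket, div_self two_ne_zero, Real.rpow_one]
    rw [← htwo, ← bracket_add, sub_add_cancel]
  have hinner : |inner ℝ x v| ≤ (1 + ‖x‖ ^ 2) * ‖v‖ := by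
    refine (abs_real_inner_le_norm x v).trans ?_
    gcongr
    nlinarith [sq_nonneg (‖x‖ - 1), sq_nonneg ‖x‖]
  rw [(hasFDerivAt_bracket σ x).fderiv]
  calc |σ * bracket (σ - 2) x * inner ℝ x v|
      = |σ| * bracket (σ - 2) x * |inner ℝ x v| := by rw [abs_mul, abs_mul, abs_of_pos hb]
    _ ≤ |σ| * bracket (σ - 2) x * ((1 + ‖x‖ ^ 2) * ‖v‖) := by gcongr
    _ = |σ| * bracket σ x * ‖v‖ := by rw [hsplit]; ring

end BracketCalculus

section LocalLp

variable {n : ℕ} {F : Type*} [NormedAddCommGroup F]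

/-- `f` belongs to `L^p` on every compact set. -/
def MemLpLoc (p : ENNReal) (f : E n → F) : Prop :=
  ∀ ⦃K : Set (E n)⦄, IsCompact K → MemLp f p (volume.restrict K)

namespace MemLpLoc

variable {p q : ENNReal} {f : E n → F}

lemma mono_exponent (hf : MemLpLoc q f) (hpq : p ≤ q) : MemLpLoc p f := fun K hK =>
  have : IsFiniteMeasure (volume.restrict K) := ⟨by simpa using hK.measure_lt_top⟩
  (hf hK).mono_exponent hpq

lemma locallyIntegrable (hf : MemLpLoc p f) (hp : 1 ≤ p) : LocallyIntegrable f volume :=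
  locallyIntegrable_iff.2 fun _ hK => memLp_one_iff_integrable.1 (hf.mono_exponent hp hK)

lemma smul [NormedSpace ℝ F] {r : ENNReal} [ENNReal.HolderTriple p q r] {A : E n → ℝ}
    (hA : MemLpLoc p A) (hf : MemLpLoc q f) : MemLpLoc r fun x => A x • f x :=
  fun _ hK => (hf hK).smul (hA hK)

end MemLpLoc

end LocalLp

section WeightedLp

variable {n : ℕ} {F : Type*} [NormedAddCommGroup F] [NormedSpace ℝ F]

lemma integrable_bracket {s : ℝ} (hs : n < s) : Integrable (bracket (-s) : E n → ℝ) :=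
  integrable_rpow_neg_one_add_norm_sq (by simpa using hs)

lemma memLp_bracket {τ q : ℝ} (hq : 0 < q) (h : n < τ * q) :
    MemLp (bracket (-τ) : E n → ℝ) (ENNReal.ofReal q) volume := by
  rw [← integrable_norm_rpow_iff (continuous_bracket _).aestronglyMeasurable (by simpa using hq)
    ENNReal.ofReal_ne_top]
  refine (integrable_bracket h).congr (.of_forall fun x => ?_)
  beta_reduce
  rw [norm_bracket, ENNReal.toReal_ofReal hq.le, bracket_rpow, neg_mul]

lemma toReal_inv_lt_half {p : ENNReal} (hp : 2 < p) : (p⁻¹).toReal < 1 / 2 := by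
  have h := ENNReal.toReal_strict_mono (by simp) (ENNReal.inv_lt_inv.2 hp)
  simpa using h

lemma holderTriple_two {p : ENNReal} (hp : 2 < p) :
    ENNReal.HolderTriple p (ENNReal.ofReal (1 / 2 - (p⁻¹).toReal)⁻¹) 2 := by
  have hgap : 0 < 1 / 2 - (p⁻¹).toReal := sub_pos.2 (toReal_inv_lt_half hp)
  have hfin : p⁻¹ ≠ ⊤ := ((ENNReal.inv_lt_inv.2 hp).trans_le le_top).ne
  have htwo : (2⁻¹ : ENNReal) = ENNReal.ofReal (1 / 2) := by
    rw [one_div, ENNReal.ofReal_inv_of_pos two_pos, ENNReal.ofReal_ofNat]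
  constructor
  calc p⁻¹ + (ENNReal.ofReal (1 / 2 - (p⁻¹).toReal)⁻¹)⁻¹
      = ENNReal.ofReal (p⁻¹).toReal + ENNReal.ofReal (1 / 2 - (p⁻¹).toReal) := by
        rw [ENNReal.ofReal_inv_of_pos hgap, inv_inv, ENNReal.ofReal_toReal hfin]
    _ = 2⁻¹ := by
        rw [← ENNReal.ofReal_add ENNReal.toReal_nonneg hgap.le, add_sub_cancel, htwo]

lemma memWLp_iff {p : ENNReal} {σ : ℝ} {f : E n → F} :
    MemWLp p σ f ↔ MemLp (fun x => bracket σ x • f x) p volume := Iff.rfl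

namespace MemWLp

variable {p : ENNReal} {σ τ : ℝ} {f : E n → F}

lemma aestronglyMeasurable (hf : MemWLp p σ f) : AEStronglyMeasurable f volume := by
  refine ((continuous_bracket (-σ)).aestronglyMeasurable.smul
    (memWLp_iff.1 hf).aestronglyMeasurable).congr (.of_forall fun x => ?_)
  simp only [Pi.smul_apply', smul_smul, bracket_neg_mul, one_smul]

lemma of_le {F' : Type*} [NormedAddCommGroup F'] [NormedSpace ℝ F'] {g : E n → F'} {C : ℝ}
    (hf : MemWLp p τ f) (hσ : σ ≤ τ) (hg : AEStronglyMeasurable g volume)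
    (h : ∀ᵐ x, ‖g x‖ ≤ C * ‖f x‖) : MemWLp p σ g := by
  refine MemLp.of_le_mul (c := C) (memWLp_iff.1 hf)
    ((continuous_bracket σ).aestronglyMeasurable.smul hg) ?_
  filter_upwards [h] with x hx
  have hτ := bracket_pos τ x
  calc ‖bracket σ x • g x‖ = bracket σ x * ‖g x‖ := by rw [norm_smul, norm_bracket]
    _ ≤ bracket τ x * (C * ‖f x‖) := by gcongr; exact bracket_mono hσ x
    _ = C * ‖bracket τ x • f x‖ := by rw [norm_smul, norm_bracket, mul_left_comm]

lemma mono (hf : MemWLp p τ f) (hσ : σ ≤ τ) : MemWLp p σ f :=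
  hf.of_le (C := 1) hσ hf.aestronglyMeasurable (by simp)

lemma congr {g : E n → F} (hf : MemWLp p σ f) (h : f =ᵐ[volume] g) : MemWLp p σ g :=
  hf.of_le (C := 1) le_rfl (hf.aestronglyMeasurable.congr h) (h.mono fun x hx => by simp [hx])

lemma add {g : E n → F} (hf : MemWLp p σ f) (hg : MemWLp p σ g) :
    MemWLp p σ fun x => f x + g x := by
  refine memWLp_iff.2 (((memWLp_iff.1 hf).add (memWLp_iff.1 hg)).ae_eq (.of_forall fun x => ?_))
  simp only [Pi.add_apply, smul_add]

lemma smul {q r : ENNReal} {A : E n → ℝ} [ENNReal.HolderTriple p q r] (hA : MemWLp p σ A)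
    (hf : MemWLp q τ f) : MemWLp r (σ + τ) fun x => A x • f x := by
  refine memWLp_iff.2 (((memWLp_iff.1 hf).smul (memWLp_iff.1 hA)).ae_eq (.of_forall fun x => ?_))
  simp only [Pi.smul_apply', smul_smul, bracket_add, smul_eq_mul, mul_right_comm]

lemma two_of_lt (hp : 2 < p) (hf : MemWLp p τ f) (h : σ < τ - n * (1 / 2 - (p⁻¹).toReal)) :
    MemWLp 2 σ f := by
  have hgap : 0 < 1 / 2 - (p⁻¹).toReal := sub_pos.2 (toReal_inv_lt_half hp)
  have := holderTriple_two hp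
  have hone : MemWLp (ENNReal.ofReal (1 / 2 - (p⁻¹).toReal)⁻¹) (σ - τ)
      (fun _ : E n => (1 : ℝ)) := by
    have hweight : (n : ℝ) < (τ - σ) * (1 / 2 - (p⁻¹).toReal)⁻¹ := by
      rw [← div_eq_mul_inv, lt_div_iff₀ hgap]
      linarith
    simpa [memWLp_iff] using memLp_bracket (inv_pos.2 hgap) hweight
  simpa using hone.smul (r := 2) hf

lemma smul_one_of_lt {A : E n → ℝ} {α : ℝ} (hp : 2 < p) (hA : MemWLp p τ A)
    (hf : MemWLp 2 (-σ) f) (h : σ - α < τ - n * (1 / 2 - (p⁻¹).toReal)) :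
    MemWLp 1 (-α) fun x => A x • f x := by
  have hweight : -α = σ - α + -σ := by ring
  rw [hweight]
  exact (hA.two_of_lt hp h).smul hf

lemma memLpLoc (hf : MemWLp p σ f) : MemLpLoc p f := by
  intro K hK
  obtain ⟨C, hC⟩ := hK.exists_bound_of_continuousOn (continuous_bracket (-σ)).continuousOn
  refine MemLp.of_le_mul (c := C) ((memWLp_iff.1 hf).restrict _)
    hf.aestronglyMeasurable.restrict ?_
  filter_upwards [ae_restrict_mem hK.measurableSet] with x hx
  calc ‖f x‖ = ‖bracket (-σ) x‖ * ‖bracket σ x • f x‖ := by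
        rw [← norm_smul, smul_smul, bracket_neg_mul, one_smul]
    _ ≤ C * ‖bracket σ x • f x‖ := by gcongr; exact hC x hx

lemma lintegral_lt_top (hf : MemWLp 1 σ f) :
    ∫⁻ x, ENNReal.ofReal (bracket σ x) * ‖f x‖ₑ < ⊤ := by
  refine lt_of_eq_of_lt (lintegral_congr fun x => ?_)
    (memLp_one_iff_integrable.1 (memWLp_iff.1 hf)).hasFiniteIntegral
  rw [enorm_smul, Real.enorm_of_nonneg (bracket_pos _ _).le]

end MemWLp

lemma memWLp_two_iff_lintegral_lt_top {σ : ℝ} {f : E n → F} (hf : AEStronglyMeasurable f volume) :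
    MemWLp 2 (-σ) f ↔ ∫⁻ x, ‖f x‖ₑ ^ 2 * ENNReal.ofReal (bracket (-(2 * σ)) x) < ⊤ := by
  have hpoint (x : E n) : ‖f x‖ₑ ^ 2 * ENNReal.ofReal (bracket (-(2 * σ)) x)
      = ‖bracket (-σ) x • f x‖ₑ ^ (2 : ENNReal).toReal := by
    rw [← mul_neg, ← bracket_sq, ENNReal.ofReal_pow (bracket_pos _ _).le, enorm_smul,
      Real.enorm_of_nonneg (bracket_pos _ _).le, ENNReal.toReal_ofNat, ENNReal.rpow_two, mul_pow,
      mul_comm]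
  simp_rw [hpoint]
  rw [memWLp_iff, MemLp, ← eLpNorm_lt_top_iff_lintegral_rpow_enorm_lt_top (by simp) (by simp)]
  exact and_iff_right ((continuous_bracket _).aestronglyMeasurable.smul hf)

end WeightedLp

section WeakDerivative

variable {n : ℕ} {F : Type*} [NormedAddCommGroup F] [NormedSpace ℝ F]

lemma continuous_fderiv_apply {φ : E n → F} (hφ : ContDiff ℝ 1 φ) (v : E n) :
    Continuous fun x => fderiv ℝ φ x v :=
  (hφ.continuous_fderiv one_ne_zero).clm_apply continuous_const

lemma locallyIntegrable_continuous_smul {f : E n → F} (hf : LocallyIntegrable f volume)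
    {ψ : E n → ℝ} (hψ : Continuous ψ) : LocallyIntegrable (fun x => ψ x • f x) volume := by
  rw [← locallyIntegrableOn_univ] at hf ⊢
  exact hf.continuousOn_smul isOpen_univ.isLocallyClosed hψ.continuousOn

lemma hasWeakPartial_of_contDiff (i : Fin n) {u : E n → F} (hu : ContDiff ℝ 1 u) :
    HasWeakPartial i u (fun x => fderiv ℝ u x (EuclideanSpace.single i 1)) := by
  have hdu := continuous_fderiv_apply hu (EuclideanSpace.single i 1)
  refine ⟨hu.continuous.locallyIntegrable, hdu.locallyIntegrable, fun φ hφ hφc => ?_⟩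
  have hφ1 : ContDiff ℝ 1 φ := hφ.of_le (by simp)
  rw [integral_smul_fderiv_eq_neg_fderiv_smul_of_integrable _ _ _
    (fun x _ => hφ1.differentiable one_ne_zero x) (fun x _ => hu.differentiable one_ne_zero x),
    neg_neg]
  · exact ((continuous_fderiv_apply hφ1 _).smul hu.continuous).integrable_of_hasCompactSupport
      (hφc.fderiv_apply ℝ _).smul_right
  · exact (hφ.continuous.smul hdu).integrable_of_hasCompactSupport hφc.smul_right
  · exact (hφ.continuous.smul hu.continuous).integrable_of_hasCompactSupport hφc.smul_right

namespace HasWeakPartial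

variable {i : Fin n} {f g : E n → F}

lemma ae_eq [CompleteSpace F] {g' : E n → F} (h : HasWeakPartial i f g)
    (h' : HasWeakPartial i f g') : g =ᵐ[volume] g' :=
  ae_eq_of_integral_contDiff_smul_eq h.2.1 h'.2.1 fun φ hφ hφc =>
    neg_injective ((h.2.2 φ hφ hφc).symm.trans (h'.2.2 φ hφ hφc))

lemma weakPartial_ae_eq [CompleteSpace F] (h : HasWeakPartial i f g) :
    weakPartial i f =ᵐ[volume] g := by
  have hex : ∃ g, HasWeakPartial i f g := ⟨g, h⟩
  rw [weakPartial, dif_pos hex]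
  exact hex.choose_spec.ae_eq h

lemma clm_comp [CompleteSpace F] {F' : Type*} [NormedAddCommGroup F'] [NormedSpace ℝ F']
    [CompleteSpace F'] (h : HasWeakPartial i f g) (L : F →L[ℝ] F') :
    HasWeakPartial i (fun x => L (f x)) (fun x => L (g x)) := by
  have hloc {u : E n → F} (hu : LocallyIntegrable u volume) :
      LocallyIntegrable (fun x => L (u x)) volume :=
    locallyIntegrable_iff.2 fun K hK => L.integrable_comp (hu.integrableOn_isCompact hK)
  refine ⟨hloc h.1, hloc h.2.1, fun φ hφ hφc => ?_⟩
  have hdφ := continuous_fderiv_apply (hφ.of_le (by simp)) (EuclideanSpace.single i 1)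
  simp_rw [← map_smul L]
  rw [L.integral_comp_comm (h.1.integrable_smul_left_of_hasCompactSupport hdφ
      (hφc.fderiv_apply ℝ _)),
    L.integral_comp_comm (h.2.1.integrable_smul_left_of_hasCompactSupport hφ.continuous hφc),
    h.2.2 φ hφ hφc, map_neg]

lemma contDiff_smul (h : HasWeakPartial i f g) {ψ : E n → ℝ} (hψ : ContDiff ℝ ∞ ψ) :
    HasWeakPartial i (fun x => ψ x • f x)
      (fun x => fderiv ℝ ψ x (EuclideanSpace.single i 1) • f x + ψ x • g x) := by
  have hdψf := locallyIntegrable_continuous_smul h.1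
    (continuous_fderiv_apply (hψ.of_le (by simp)) (EuclideanSpace.single i 1))
  have hψg := locallyIntegrable_continuous_smul h.2.1 hψ.continuous
  have hψf := locallyIntegrable_continuous_smul h.1 hψ.continuous
  refine ⟨hψf, hdψf.add hψg, fun φ hφ hφc => ?_⟩
  have hleibniz (x : E n) : fderiv ℝ (fun x => φ x * ψ x) x (EuclideanSpace.single i 1)
      = φ x * fderiv ℝ ψ x (EuclideanSpace.single i 1)
        + fderiv ℝ φ x (EuclideanSpace.single i 1) * ψ x := by
    rw [fderiv_fun_mul (hφ.differentiable (by simp) x) (hψ.differentiable (by simp) x)]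
    simp [mul_comm]
  have hparts := h.2.2 (fun x => φ x * ψ x) (hφ.mul hψ) hφc.mul_right
  have hφdψf := hdψf.integrable_smul_left_of_hasCompactSupport hφ.continuous hφc
  simp_rw [hleibniz, add_smul, mul_smul] at hparts
  rw [integral_add hφdψf (hψf.integrable_smul_left_of_hasCompactSupport
    (continuous_fderiv_apply (hφ.of_le (by simp)) _) (hφc.fderiv_apply ℝ _))] at hparts
  simp_rw [smul_add]
  rw [integral_add hφdψf (hψg.integrable_smul_left_of_hasCompactSupport hφ.continuous hφc),
    neg_add, ← hparts]
  abel

lemma integral_fderiv_smul_comp_sub (h : HasWeakPartial i f g) {φ : E n → ℝ} (hφ : ContDiff ℝ ∞ φ)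
    (hφc : HasCompactSupport φ) (y : E n) :
    ∫ x, fderiv ℝ φ x (EuclideanSpace.single i 1) • f (x - y) = - ∫ x, φ x • g (x - y) := by
  have hparts := h.2.2 (fun x => φ (x + y)) (hφ.comp (contDiff_id.add contDiff_const))
    (hφc.comp_homeomorph (Homeomorph.addRight y))
  simp_rw [fderiv_comp_add_right] at hparts
  rw [← integral_sub_right_eq_self _ y,
    ← integral_sub_right_eq_self (fun x => φ (x + y) • _) y] at hparts
  simpa only [sub_add_cancel] using hparts

end HasWeakPartial

/-- Vague convergence of the densities `f k` to `f₀`. -/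
def TendstoVaguely (f : ℕ → E n → F) (f₀ : E n → F) : Prop :=
  ∀ ψ : E n → ℝ, Continuous ψ → HasCompactSupport ψ →
    Filter.Tendsto (fun k => ∫ x, ψ x • f k x) Filter.atTop (nhds (∫ x, ψ x • f₀ x))

namespace TendstoVaguely

variable {f g : ℕ → E n → F} {f₀ g₀ : E n → F}

lemma of_dominated {b : E n → ℝ} (hf : ∀ k, AEStronglyMeasurable (f k) volume)
    (hb : LocallyIntegrable b volume) (hfb : ∀ k, ∀ᵐ x, ‖f k x‖ ≤ b x)
    (hlim : ∀ᵐ x, Filter.Tendsto (fun k => f k x) Filter.atTop (nhds (f₀ x))) :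
    TendstoVaguely f f₀ := by
  intro ψ hψ hψc
  refine tendsto_integral_of_dominated_convergence (fun x => |ψ x| • b x)
    (fun k => hψ.aestronglyMeasurable.smul (hf k))
    (hb.integrable_smul_left_of_hasCompactSupport hψ.abs (hψc.comp_left abs_zero)) (fun k => ?_) ?_
  · filter_upwards [hfb k] with x hx
    rw [norm_smul, Real.norm_eq_abs, smul_eq_mul]
    gcongr
  · filter_upwards [hlim] with x hx using hx.const_smul _

lemma add (hf : TendstoVaguely f f₀) (hg : TendstoVaguely g g₀)
    (hfloc : ∀ k, LocallyIntegrable (f k) volume) (hgloc : ∀ k, LocallyIntegrable (g k) volume)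
    (hf₀ : LocallyIntegrable f₀ volume) (hg₀ : LocallyIntegrable g₀ volume) :
    TendstoVaguely (fun k x => f k x + g k x) (fun x => f₀ x + g₀ x) := by
  intro ψ hψ hψc
  have hadd {u v : E n → F} (hu : LocallyIntegrable u volume) (hv : LocallyIntegrable v volume) :
      ∫ x, ψ x • (u x + v x) = (∫ x, ψ x • u x) + ∫ x, ψ x • v x := by
    simp_rw [smul_add]
    exact integral_add (hu.integrable_smul_left_of_hasCompactSupport hψ hψc)
      (hv.integrable_smul_left_of_hasCompactSupport hψ hψc)
  simp_rw [hadd (hfloc _) (hgloc _), hadd hf₀ hg₀]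
  exact (hf ψ hψ hψc).add (hg ψ hψ hψc)

end TendstoVaguely

lemma hasWeakPartial_of_tendstoVaguely {i : Fin n} {f g : ℕ → E n → F} {f₀ g₀ : E n → F}
    (h : ∀ k, HasWeakPartial i (f k) (g k)) (hf₀ : LocallyIntegrable f₀ volume)
    (hg₀ : LocallyIntegrable g₀ volume) (hf : TendstoVaguely f f₀) (hg : TendstoVaguely g g₀) :
    HasWeakPartial i f₀ g₀ := by
  refine ⟨hf₀, hg₀, fun φ hφ hφc => ?_⟩
  have hlim := hf _ (continuous_fderiv_apply (hφ.of_le (by simp)) (EuclideanSpace.single i 1))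
    (hφc.fderiv_apply ℝ _)
  simp_rw [(h _).2.2 φ hφ hφc] at hlim
  exact tendsto_nhds_unique hlim (hg φ hφ.continuous hφc).neg

end WeakDerivative

section SchurTest

lemma lintegral_sq_le_of_sq_le_mul {X : Type*} [MeasurableSpace X] {μ : Measure X}
    {K P Q : X → ENNReal} (hP : AEMeasurable P μ) (hQ : AEMeasurable Q μ)
    (h : ∀ x, K x ^ 2 ≤ P x * Q x) :
    (∫⁻ x, K x ∂μ) ^ 2 ≤ (∫⁻ x, P x ∂μ) * ∫⁻ x, Q x ∂μ := by
  have hsqrt_sq (t : ENNReal) : (t ^ (1 / 2 : ℝ)) ^ 2 = t := by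
    rw [← ENNReal.rpow_natCast, ← ENNReal.rpow_mul]
    norm_num
  have hsq_sqrt (t : ENNReal) : (t ^ 2) ^ (1 / 2 : ℝ) = t := by
    rw [← ENNReal.rpow_natCast, ← ENNReal.rpow_mul]
    norm_num
  have hK (x : X) : K x ≤ P x ^ (1 / 2 : ℝ) * Q x ^ (1 / 2 : ℝ) := by
    rw [← ENNReal.mul_rpow_of_nonneg _ _ (by norm_num), ← hsq_sqrt (K x)]
    gcongr
    exact h x
  calc (∫⁻ x, K x ∂μ) ^ 2
      ≤ (∫⁻ x, P x ^ (1 / 2 : ℝ) * Q x ^ (1 / 2 : ℝ) ∂μ) ^ 2 := by gcongr with x; exact hK x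
    _ ≤ ((∫⁻ x, (P x ^ (1 / 2 : ℝ)) ^ (2 : ℝ) ∂μ) ^ (1 / 2 : ℝ)
          * (∫⁻ x, (Q x ^ (1 / 2 : ℝ)) ^ (2 : ℝ) ∂μ) ^ (1 / 2 : ℝ)) ^ 2 := by
        gcongr
        exact ENNReal.lintegral_mul_le_Lp_mul_Lq μ Real.HolderConjugate.two_two
          (hP.pow_const _) (hQ.pow_const _)
    _ = (∫⁻ x, P x ∂μ) * ∫⁻ x, Q x ∂μ := by
        simp only [mul_pow, hsqrt_sq, ENNReal.rpow_two]

lemma lintegral_sq_mul_le_of_sq_le_mul {X Y : Type*} [MeasurableSpace X] [MeasurableSpace Y]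
    {μ : Measure X} {ν : Measure Y} [SFinite μ] [SFinite ν] {K P Q : X → Y → ENNReal}
    {w : X → ENNReal} {N : ENNReal} (hw : Measurable w) (hP : ∀ x, AEMeasurable (P x) ν)
    (hQ : AEMeasurable (Function.uncurry Q) (μ.prod ν)) (hK : ∀ x y, K x y ^ 2 ≤ P x y * Q x y)
    (hN : ∀ x, ∫⁻ y, P x y ∂ν ≤ N) :
    ∫⁻ x, (∫⁻ y, K x y ∂ν) ^ 2 * w x ∂μ ≤ N * ∫⁻ y, ∫⁻ x, Q x y * w x ∂μ ∂ν := by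
  have hQw : AEMeasurable (fun z : X × Y => Q z.1 z.2 * w z.1) (μ.prod ν) :=
    hQ.mul (hw.comp measurable_fst).aemeasurable
  have hQx : ∀ᵐ x ∂μ, AEMeasurable (Q x) ν := by
    filter_upwards [hQ.aestronglyMeasurable.prodMk_left] with x hx using hx.aemeasurable
  calc ∫⁻ x, (∫⁻ y, K x y ∂ν) ^ 2 * w x ∂μ
      ≤ ∫⁻ x, N * ∫⁻ y, Q x y * w x ∂ν ∂μ := by
        refine lintegral_mono_ae ?_
        filter_upwards [hQx] with x hx
        rw [lintegral_mul_const'' _ hx, ← mul_assoc]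
        gcongr
        exact (lintegral_sq_le_of_sq_le_mul (hP x) hx (hK x)).trans (by gcongr; exact hN x)
    _ = N * ∫⁻ y, ∫⁻ x, Q x y * w x ∂μ ∂ν := by
        rw [lintegral_const_mul'' _ hQw.lintegral_prod_right', lintegral_lintegral_swap hQw]

end SchurTest

section WeightedConvolution

variable {n : ℕ} {k g w : E n → ENNReal}

lemma aemeasurable_comp_sub_mul (hk : Measurable k) (hg : AEMeasurable g volume) :
    AEMeasurable (fun z : E n × E n => k (z.1 - z.2) * g z.2) (volume.prod volume) :=
  (hk.comp (measurable_fst.sub measurable_snd)).aemeasurable.mul hg.comp_snd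

lemma lintegral_conv_sq_mul_le {D : ENNReal} (hk : Measurable k) (hg : AEMeasurable g volume)
    (hw : Measurable w) (h : ∀ x y, k (x - y) * w x ≤ D * (k (x - y) * w y)) :
    ∫⁻ x, (∫⁻ y, k (x - y) * g y) ^ 2 * w x
      ≤ (∫⁻ z, k z) ^ 2 * D * ∫⁻ y, g y ^ 2 * w y := by
  set A := ∫⁻ z, k z
  calc ∫⁻ x, (∫⁻ y, k (x - y) * g y) ^ 2 * w x
      ≤ A * ∫⁻ y, ∫⁻ x, k (x - y) * g y ^ 2 * w x :=
        lintegral_sq_mul_le_of_sq_le_mul (P := fun x y => k (x - y))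
          (Q := fun x y => k (x - y) * g y ^ 2) hw
          (fun x => (hk.comp (measurable_const.sub measurable_id)).aemeasurable)
          (aemeasurable_comp_sub_mul hk (hg.pow_const 2)) (fun x y => le_of_eq (by ring))
          (fun x => (lintegral_sub_left_eq_self k x).le)
    _ ≤ A * ∫⁻ y, A * D * (g y ^ 2 * w y) := by
        gcongr with y
        calc ∫⁻ x, k (x - y) * g y ^ 2 * w x
            ≤ ∫⁻ x, k (x - y) * (D * (g y ^ 2 * w y)) := by
              refine lintegral_mono fun x => ?_
              calc k (x - y) * g y ^ 2 * w x = k (x - y) * w x * g y ^ 2 := by ring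
                _ ≤ D * (k (x - y) * w y) * g y ^ 2 := by gcongr ?_ * _; exact h x y
                _ = k (x - y) * (D * (g y ^ 2 * w y)) := by ring
          _ = A * D * (g y ^ 2 * w y) := by
              rw [lintegral_mul_const _ (by fun_prop),
                lintegral_sub_right_eq_self k y, mul_assoc]
    _ = A ^ 2 * D * ∫⁻ y, g y ^ 2 * w y := by
        rw [lintegral_const_mul'' _ ((hg.pow_const 2).fun_mul hw.aemeasurable)]
        ring

lemma lintegral_conv_sq_mul_le_sq_lintegral {m m' : E n → ENNReal} {D : ENNReal}
    (hk : Measurable k) (hg : AEMeasurable g volume) (hw : Measurable w) (hm : Measurable m)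
    (hm' : Measurable m') (hmm : ∀ y, m' y * m y = 1)
    (h : ∀ y, ∫⁻ x, k (x - y) ^ 2 * w x ≤ D * m' y ^ 2) :
    ∫⁻ x, (∫⁻ y, k (x - y) * g y) ^ 2 * w x ≤ D * (∫⁻ y, m' y * g y) ^ 2 := by
  set N := ∫⁻ y, m' y * g y
  have hmg : AEMeasurable (fun y => m y * g y) volume := hm.aemeasurable.mul hg
  calc ∫⁻ x, (∫⁻ y, k (x - y) * g y) ^ 2 * w x
      ≤ N * ∫⁻ y, ∫⁻ x, k (x - y) ^ 2 * (m y * g y) * w x := by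
        refine lintegral_sq_mul_le_of_sq_le_mul (P := fun _ y => m' y * g y)
          (Q := fun x y => k (x - y) ^ 2 * (m y * g y)) hw (fun _ => hm'.aemeasurable.mul hg)
          (aemeasurable_comp_sub_mul (hk.pow_const 2) hmg) (fun x y => le_of_eq ?_) fun _ => le_rfl
        calc (k (x - y) * g y) ^ 2 = m' y * m y * (k (x - y) * g y) ^ 2 := by rw [hmm, one_mul]
          _ = m' y * g y * (k (x - y) ^ 2 * (m y * g y)) := by ring
    _ ≤ N * ∫⁻ y, D * (m' y * g y) := by
        gcongr with y
        calc ∫⁻ x, k (x - y) ^ 2 * (m y * g y) * w x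
            = (∫⁻ x, k (x - y) ^ 2 * w x) * (m y * g y) := by
              rw [← lintegral_mul_const]
              · simp only [mul_right_comm]
              · exact ((hk.comp (measurable_id.sub measurable_const)).pow_const 2).mul hw
          _ ≤ D * m' y ^ 2 * (m y * g y) := by gcongr; exact h y
          _ = D * (m' y * g y) * (m' y * m y) := by ring
          _ = D * (m' y * g y) := by rw [hmm, mul_one]
    _ = D * N ^ 2 := by
        rw [lintegral_const_mul'' _ (hm'.aemeasurable.fun_mul hg)]
        ring

lemma ennreal_add_sq_le (a b : ENNReal) : (a + b) ^ 2 ≤ 2 * (a ^ 2 + b ^ 2) := by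
  have h := ENNReal.rpow_add_le_mul_rpow_add_rpow a b (p := 2) (by norm_num)
  norm_num at h
  exact h

lemma lintegral_conv_sq_mul_add_lt_top {k₁ k₂ : E n → ENNReal} (hk₁ : Measurable k₁)
    (hg : AEMeasurable g volume) (hw : Measurable w)
    (h₁ : ∫⁻ x, (∫⁻ y, k₁ (x - y) * g y) ^ 2 * w x < ⊤)
    (h₂ : ∫⁻ x, (∫⁻ y, k₂ (x - y) * g y) ^ 2 * w x < ⊤) :
    ∫⁻ x, (∫⁻ y, (k₁ + k₂) (x - y) * g y) ^ 2 * w x < ⊤ := by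
  have hconv : AEMeasurable (fun x => (∫⁻ y, k₁ (x - y) * g y) ^ 2 * w x) volume :=
    ((aemeasurable_comp_sub_mul hk₁ hg).lintegral_prod_right'.pow_const 2).mul hw.aemeasurable
  calc ∫⁻ x, (∫⁻ y, (k₁ + k₂) (x - y) * g y) ^ 2 * w x
      ≤ ∫⁻ x, 2 * ((∫⁻ y, k₁ (x - y) * g y) ^ 2 * w x + (∫⁻ y, k₂ (x - y) * g y) ^ 2 * w x) := by
        refine lintegral_mono fun x => ?_
        simp only [Pi.add_apply, add_mul]
        rw [lintegral_add_left' (by fun_prop), ← add_mul, ← mul_assoc]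
        gcongr
        exact ennreal_add_sq_le _ _
    _ < ⊤ := by
        rw [lintegral_const_mul' _ _ (by finiteness), lintegral_add_left' hconv]
        exact ENNReal.mul_lt_top (by finiteness) (ENNReal.add_lt_top.2 ⟨h₁, h₂⟩)

lemma measurable_ofReal_bracket (σ : ℝ) :
    Measurable fun x : E n => ENNReal.ofReal (bracket σ x) :=
  (continuous_bracket σ).measurable.ennreal_ofReal

/- Insert `1 = ⟨y⟩^{-β} ⟨y⟩^β` and bound `⟨y⟩^β` by `⟨x⟩^β + ⟨x - y⟩^β`. -/
lemma bracket_neg_sub_mul_bracket_neg_le {X : Type*} [SeminormedAddCommGroup X] {β s : ℝ}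
    (hβ : 0 ≤ β) (hβs : β ≤ s) (x y : X) :
    bracket (-β) (x - y) * bracket (-s) x
      ≤ 4 ^ (β / 2) * (2 * bracket (-s) x + bracket (-s) (x - y)) * bracket (-β) y := by
  have hpos (σ : ℝ) (z : X) := bracket_pos σ z
  have hshift : bracket (-s) x * bracket β x * bracket (-β) (x - y)
      ≤ bracket (-s) x + bracket (-s) (x - y) := by
    have h := bracket_neg_mul_bracket_neg_le (sub_nonneg.2 hβs) hβ x (x - y)
    rwa [sub_add_cancel, neg_sub, sub_eq_neg_add, bracket_add] at h
  calc bracket (-β) (x - y) * bracket (-s) x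
      = bracket (-β) (x - y) * bracket (-s) x * (bracket (-β) y * bracket β y) := by
        rw [bracket_neg_mul, mul_one]
    _ ≤ bracket (-β) (x - y) * bracket (-s) x
          * (bracket (-β) y * (4 ^ (β / 2) * (bracket β x + bracket β (x - y)))) := by
        have := hpos (-β) (x - y)
        have := hpos (-s) x
        have := hpos (-β) y
        gcongr
        exact bracket_le_add hβ x y
    _ = 4 ^ (β / 2) * (bracket (-s) x * bracket β x * bracket (-β) (x - y)
          + bracket (-s) x * (bracket (-β) (x - y) * bracket β (x - y))) * bracket (-β) y := by
        ring
    _ ≤ 4 ^ (β / 2) * (bracket (-s) x + bracket (-s) (x - y) + bracket (-s) x * 1)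
          * bracket (-β) y := by
        have := hpos (-β) y
        rw [bracket_neg_mul]
        gcongr
    _ = 4 ^ (β / 2) * (2 * bracket (-s) x + bracket (-s) (x - y)) * bracket (-β) y := by ring

lemma exists_lintegral_bracket_sub_mul_bracket_le {β s : ℝ} (hβ : 0 ≤ β) (hβs : β ≤ s)
    (hs : n < s) :
    ∃ D : ENNReal, D ≠ ⊤ ∧ ∀ y : E n,
      ∫⁻ x : E n, ENNReal.ofReal (bracket (-β) (x - y)) * ENNReal.ofReal (bracket (-s) x)
        ≤ D * ENNReal.ofReal (bracket (-β) y) := by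
  have hint := integrable_bracket hs
  set I : ℝ := ∫ x : E n, bracket (-s) x
  refine ⟨ENNReal.ofReal (4 ^ (β / 2) * (2 * I + I)), ENNReal.ofReal_ne_top, fun y => ?_⟩
  have hmaj : Integrable fun x : E n =>
      4 ^ (β / 2) * (2 * bracket (-s) x + bracket (-s) (x - y)) * bracket (-β) y :=
    (((hint.const_mul 2).add (hint.comp_sub_right y)).const_mul _).mul_const _
  calc ∫⁻ x : E n, ENNReal.ofReal (bracket (-β) (x - y)) * ENNReal.ofReal (bracket (-s) x)
      ≤ ∫⁻ x : E n, ENNReal.ofReal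
          (4 ^ (β / 2) * (2 * bracket (-s) x + bracket (-s) (x - y)) * bracket (-β) y) := by
        refine lintegral_mono fun x => ?_
        rw [← ENNReal.ofReal_mul (bracket_pos _ _).le]
        exact ENNReal.ofReal_le_ofReal (bracket_neg_sub_mul_bracket_neg_le hβ hβs x y)
    _ = ENNReal.ofReal (4 ^ (β / 2) * (2 * I + I) * bracket (-β) y) := by
        rw [← ofReal_integral_eq_lintegral_ofReal hmaj (.of_forall fun x => ?_)]
        · rw [integral_mul_const, integral_const_mul,
            integral_add (hint.const_mul 2) (hint.comp_sub_right y), integral_const_mul,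
            integral_sub_right_eq_self (fun z : E n => bracket (-s) z) y]
        · have := bracket_pos (-s) x
          have := bracket_pos (-s) (x - y)
          have := bracket_pos (-β) y
          positivity
    _ = ENNReal.ofReal (4 ^ (β / 2) * (2 * I + I)) * ENNReal.ofReal (bracket (-β) y) :=
        ENNReal.ofReal_mul' (bracket_pos _ _).le

end WeightedConvolution

section OutgoingKernel

variable {n : ℕ}

/-- A locally integrable convolution kernel on `ℝⁿ` of size `|z|^{-α}` at infinity; both the
outgoing Green function and its gradient are of this kind. -/
structure IsOutgoingKernel (α C : ℝ) (Γ : E n → ℂ) : Prop where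
  measurable : Measurable Γ
  locallyIntegrable : LocallyIntegrable Γ volume
  norm_le : ∀ z, 1 ≤ ‖z‖ → ‖Γ z‖ ≤ C * bracket (-α) z

/-- The class `L¹_{-α} ∩ L²_{-σ}`, which convolution with an outgoing kernel of decay rate `α` maps
into `L²_{-σ}`: the first space controls the far part of the kernel, the second one the near
part. -/
structure IsSource (α σ : ℝ) (g : E n → ℂ) : Prop where
  memWLp_one : MemWLp 1 (-α) g
  memWLp_two : MemWLp 2 (-σ) g

namespace IsSource

variable {α σ : ℝ} {g : E n → ℂ}

lemma aestronglyMeasurable (hg : IsSource α σ g) : AEStronglyMeasurable g volume :=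
  hg.memWLp_two.aestronglyMeasurable

lemma near_lt_top (hg : IsSource α σ g) (hσ : 0 ≤ σ) {k : E n → ENNReal} (hk : Measurable k)
    (hsupp : ∀ z, 1 < ‖z‖ → k z = 0) (hint : ∫⁻ z, k z < ⊤) :
    ∫⁻ x, (∫⁻ y, k (x - y) * ‖g y‖ₑ) ^ 2 * ENNReal.ofReal (bracket (-(2 * σ)) x) < ⊤ := by
  set D := ENNReal.ofReal (3 ^ (2 * σ / 2))
  refine (lintegral_conv_sq_mul_le (D := D) hk hg.aestronglyMeasurable.enorm
    (measurable_ofReal_bracket _) fun x y => ?_).trans_lt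
    (ENNReal.mul_lt_top (by finiteness)
      ((memWLp_two_iff_lintegral_lt_top hg.aestronglyMeasurable).1 hg.memWLp_two))
  rcases le_or_gt ‖x - y‖ 1 with hxy | hxy
  · rw [mul_left_comm, ← ENNReal.ofReal_mul (by positivity)]
    gcongr
    exact bracket_neg_le_of_norm_sub_le_one (by linarith) hxy
  · simp only [hsupp _ hxy, zero_mul, mul_zero, le_refl]

lemma far_lt_top (hg : IsSource α σ g) (hα : 0 ≤ α) (hασ : α ≤ σ) (hσ : (n : ℝ) / 2 < σ)
    {k : E n → ENNReal} {C : ℝ} (hk : Measurable k)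
    (hbound : ∀ z, k z ≤ ENNReal.ofReal (C * bracket (-α) z)) :
    ∫⁻ x, (∫⁻ y, k (x - y) * ‖g y‖ₑ) ^ 2 * ENNReal.ofReal (bracket (-(2 * σ)) x) < ⊤ := by
  have hsq (z : E n) : ENNReal.ofReal (bracket (-α) z) ^ 2
      = ENNReal.ofReal (bracket (-(2 * α)) z) := by
    rw [← ENNReal.ofReal_pow (bracket_pos _ _).le, bracket_sq, mul_neg]
  obtain ⟨D, hD, hDle⟩ := exists_lintegral_bracket_sub_mul_bracket_le (n := n) (β := 2 * α)
    (s := 2 * σ) (by linarith) (by linarith) (by linarith)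
  refine (lintegral_conv_sq_mul_le_sq_lintegral (D := ENNReal.ofReal C ^ 2 * D) hk
    hg.aestronglyMeasurable.enorm (measurable_ofReal_bracket _) (measurable_ofReal_bracket α)
    (measurable_ofReal_bracket (-α)) (fun y => ?_) fun y => ?_).trans_lt
    (ENNReal.mul_lt_top (by finiteness) (ENNReal.pow_lt_top hg.memWLp_one.lintegral_lt_top))
  · rw [← ENNReal.ofReal_mul (bracket_pos _ _).le, bracket_neg_mul, ENNReal.ofReal_one]
  · calc ∫⁻ x, k (x - y) ^ 2 * ENNReal.ofReal (bracket (-(2 * σ)) x)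
        ≤ ∫⁻ x, ENNReal.ofReal C ^ 2 * (ENNReal.ofReal (bracket (-(2 * α)) (x - y))
            * ENNReal.ofReal (bracket (-(2 * σ)) x)) := by
          refine lintegral_mono fun x => ?_
          rw [← hsq, ← mul_assoc, ← mul_pow, ← ENNReal.ofReal_mul' (bracket_pos _ _).le]
          gcongr
          exact hbound _
      _ ≤ ENNReal.ofReal C ^ 2 * (D * ENNReal.ofReal (bracket (-(2 * α)) y)) := by
          rw [lintegral_const_mul' _ _ (by finiteness)]
          gcongr
          exact hDle y
      _ = ENNReal.ofReal C ^ 2 * D * ENNReal.ofReal (bracket (-α) y) ^ 2 := by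
          rw [hsq, mul_assoc]

end IsSource

namespace IsOutgoingKernel

variable {α σ C : ℝ} {Γ g : E n → ℂ}

lemma lintegral_conv_sq_lt_top (hΓ : IsOutgoingKernel α C Γ) (hg : IsSource α σ g) (hα : 0 ≤ α)
    (hασ : α ≤ σ) (hσ : (n : ℝ) / 2 < σ) :
    ∫⁻ x, (∫⁻ y, ‖Γ (x - y)‖ₑ * ‖g y‖ₑ) ^ 2 * ENNReal.ofReal (bracket (-(2 * σ)) x) < ⊤ := by
  set B : Set (E n) := Metric.closedBall 0 1
  have hB : MeasurableSet B := measurableSet_closedBall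
  have hsplit := Set.indicator_self_add_compl B (‖Γ ·‖ₑ)
  suffices h : ∫⁻ x, (∫⁻ y, (B.indicator (‖Γ ·‖ₑ) + Bᶜ.indicator (‖Γ ·‖ₑ)) (x - y) * ‖g y‖ₑ) ^ 2
      * ENNReal.ofReal (bracket (-(2 * σ)) x) < ⊤ by simpa only [hsplit] using h
  refine lintegral_conv_sq_mul_add_lt_top (hΓ.measurable.enorm.indicator hB)
    hg.aestronglyMeasurable.enorm
    (measurable_ofReal_bracket _) ?_ ?_
  · refine hg.near_lt_top (hα.trans hασ) (hΓ.measurable.enorm.indicator hB) (fun z hz => ?_) ?_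
    · exact Set.indicator_of_notMem (by simpa [B] using hz) _
    · rw [lintegral_indicator hB]
      exact (hΓ.locallyIntegrable.integrableOn_isCompact (isCompact_closedBall 0 1)).2
  · refine hg.far_lt_top (C := |C|) hα hασ hσ (hΓ.measurable.enorm.indicator hB.compl) fun z => ?_
    refine Set.indicator_apply_le' (fun hz => ?_) fun _ => zero_le
    rw [← ofReal_norm]
    refine ENNReal.ofReal_le_ofReal ((hΓ.norm_le z ?_).trans ?_)
    · exact (not_le.1 (by simpa [B] using hz)).le
    · exact mul_le_mul_of_nonneg_right (le_abs_self C) (bracket_pos _ _).le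

lemma aestronglyMeasurable_mul (hΓ : IsOutgoingKernel α C Γ)
    (hg : AEStronglyMeasurable g volume) :
    AEStronglyMeasurable (fun z : E n × E n => Γ (z.1 - z.2) * g z.2) (volume.prod volume) :=
  (hΓ.measurable.comp (measurable_fst.sub measurable_snd)).aestronglyMeasurable.mul hg.comp_snd

lemma memWLp_integral_norm (hΓ : IsOutgoingKernel α C Γ) (hg : IsSource α σ g) (hα : 0 ≤ α)
    (hασ : α ≤ σ) (hσ : (n : ℝ) / 2 < σ) :
    MemWLp 2 (-σ) fun x => ∫ y, ‖Γ (x - y) * g y‖ := by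
  rw [memWLp_two_iff_lintegral_lt_top
    (hΓ.aestronglyMeasurable_mul hg.aestronglyMeasurable).norm.integral_prod_right']
  refine (lintegral_mono fun x => ?_).trans_lt (hΓ.lintegral_conv_sq_lt_top hg hα hασ hσ)
  gcongr
  refine (enorm_integral_le_lintegral_enorm _).trans (le_of_eq ?_)
  simp only [enorm_norm, enorm_mul]

lemma memWLp_integral (hΓ : IsOutgoingKernel α C Γ) (hg : IsSource α σ g) (hα : 0 ≤ α)
    (hασ : α ≤ σ) (hσ : (n : ℝ) / 2 < σ) :
    MemWLp 2 (-σ) fun x => ∫ y, Γ (x - y) * g y := by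
  refine (hΓ.memWLp_integral_norm hg hα hασ hσ).of_le (C := 1) le_rfl
    (hΓ.aestronglyMeasurable_mul hg.aestronglyMeasurable).integral_prod_right' ?_
  filter_upwards with x
  rw [one_mul]
  exact (norm_integral_le_integral_norm _).trans (le_abs_self _)

lemma ae_integrable (hΓ : IsOutgoingKernel α C Γ) (hg : IsSource α σ g) (hα : 0 ≤ α)
    (hασ : α ≤ σ) (hσ : (n : ℝ) / 2 < σ) :
    ∀ᵐ x, Integrable (fun y => Γ (x - y) * g y) volume := by
  have hmeas := hΓ.aestronglyMeasurable_mul hg.aestronglyMeasurable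
  have hconv : AEMeasurable (fun x => ∫⁻ y, ‖Γ (x - y)‖ₑ * ‖g y‖ₑ) volume :=
    (aemeasurable_comp_sub_mul hΓ.measurable.enorm
      hg.aestronglyMeasurable.enorm).lintegral_prod_right'
  have hfinite := ae_lt_top' ((hconv.pow_const 2).mul
    (measurable_ofReal_bracket (-(2 * σ))).aemeasurable)
    (hΓ.lintegral_conv_sq_lt_top hg hα hασ hσ).ne
  filter_upwards [hfinite, hmeas.prodMk_left] with x hx hmx
  refine ⟨hmx, ?_⟩
  simp only [HasFiniteIntegral, enorm_mul]
  by_contra htop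
  rw [not_lt, top_le_iff] at htop
  have hweight : ENNReal.ofReal (bracket (-(2 * σ)) x) ≠ 0 := by
    simpa using bracket_pos (-(2 * σ)) x
  simp [htop, ENNReal.top_mul hweight] at hx

lemma integrable_smul_prod (hΓ : IsOutgoingKernel α C Γ) (hg : IsSource α σ g) (hα : 0 ≤ α)
    (hασ : α ≤ σ) (hσ : (n : ℝ) / 2 < σ) {φ : E n → ℝ} (hφ : Continuous φ)
    (hφc : HasCompactSupport φ) :
    Integrable (fun z : E n × E n => φ z.1 • (Γ (z.1 - z.2) * g z.2)) (volume.prod volume) := by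
  have hmeas : AEStronglyMeasurable (fun z : E n × E n => φ z.1 • (Γ (z.1 - z.2) * g z.2))
      (volume.prod volume) :=
    (hφ.comp continuous_fst).aestronglyMeasurable.smul
      (hΓ.aestronglyMeasurable_mul hg.aestronglyMeasurable)
  refine (integrable_prod_iff hmeas).2 ⟨?_, ?_⟩
  · filter_upwards [hΓ.ae_integrable hg hα hασ hσ] with x hx using hx.smul (φ x)
  · have hloc := (hΓ.memWLp_integral_norm hg hα hασ hσ).memLpLoc.locallyIntegrable (by norm_num)
    simpa only [norm_smul, integral_const_mul, smul_eq_mul] using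
      hloc.integrable_smul_left_of_hasCompactSupport hφ.norm hφc.norm

end IsOutgoingKernel

end OutgoingKernel

section SmoothNorm

variable {X : Type*} [NormedAddCommGroup X] {ε : ℝ}

/-- The smooth approximation `√(|x|² + ε)` of the norm from above. -/
def smoothNorm (ε : ℝ) (x : X) : ℝ := √(‖x‖ ^ 2 + ε)

lemma smoothNorm_pos (hε : 0 < ε) (x : X) : 0 < smoothNorm ε x :=
  Real.sqrt_pos.2 (by positivity)

lemma norm_le_smoothNorm (hε : 0 ≤ ε) (x : X) : ‖x‖ ≤ smoothNorm ε x :=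
  Real.le_sqrt_of_sq_le (by linarith)

lemma tendsto_smoothNorm (x : X) :
    Filter.Tendsto (fun k : ℕ => smoothNorm (1 / ((k : ℝ) + 1)) x) Filter.atTop (nhds ‖x‖) := by
  have hcont : Continuous fun ε => smoothNorm ε x := by
    unfold smoothNorm
    fun_prop
  have h := (hcont.tendsto 0).comp (tendsto_one_div_add_atTop_nhds_zero_nat (𝕜 := ℝ))
  rwa [smoothNorm, add_zero, Real.sqrt_sq (norm_nonneg x)] at h

variable [InnerProductSpace ℝ X]

lemma contDiff_smoothNorm (hε : 0 < ε) : ContDiff ℝ 1 (smoothNorm ε : X → ℝ) :=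
  ((contDiff_norm_sq ℝ).add contDiff_const).sqrt fun x => by positivity

lemma fderiv_smoothNorm_apply (hε : 0 < ε) (x v : X) :
    fderiv ℝ (smoothNorm ε) x v = inner ℝ x v / smoothNorm ε x := by
  have h := ((hasStrictFDerivAt_norm_sq x).hasFDerivAt.add_const ε).sqrt (by positivity)
  have hpos := smoothNorm_pos hε x
  have hfderiv : fderiv ℝ (smoothNorm ε) x
      = (1 / (2 * smoothNorm ε x)) • ((2 : ℕ) • innerSL ℝ x) := h.fderiv
  rw [hfderiv]
  simp only [_root_.smul_apply, innerSL_apply_apply, nsmul_eq_mul, smul_eq_mul]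
  field_simp
  norm_num

lemma contDiff_comp_smoothNorm {G : ℝ → ℂ} (hG : ContDiffOn ℝ 1 G (Set.Ioi 0)) (hε : 0 < ε) :
    ContDiff ℝ 1 fun x : X => G (smoothNorm ε x) :=
  hG.comp_contDiff (contDiff_smoothNorm hε) (smoothNorm_pos hε)

lemma fderiv_comp_smoothNorm_apply {G : ℝ → ℂ} (hG : ContDiffOn ℝ 1 G (Set.Ioi 0)) (hε : 0 < ε)
    (x v : X) :
    fderiv ℝ (fun x => G (smoothNorm ε x)) x v
      = ((inner ℝ x v / smoothNorm ε x : ℝ) : ℂ) * deriv G (smoothNorm ε x) := by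
  have hGdiff : DifferentiableAt ℝ G (smoothNorm ε x) :=
    (hG.contDiffAt (Ioi_mem_nhds (smoothNorm_pos hε x))).differentiableAt one_ne_zero
  have hcomp := hGdiff.hasFDerivAt.comp x
    ((contDiff_smoothNorm hε).differentiable one_ne_zero x).hasFDerivAt
  have hfderiv : fderiv ℝ (fun x => G (smoothNorm ε x)) x
      = (fderiv ℝ G (smoothNorm ε x)).comp (fderiv ℝ (smoothNorm ε) x) := hcomp.fderiv
  rw [hfderiv, ContinuousLinearMap.comp_apply, fderiv_eq_smul_deriv, fderiv_smoothNorm_apply hε,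
    Complex.real_smul]

end SmoothNorm

section RadialKernel

variable {n : ℕ} {α C : ℝ} {G : ℝ → ℂ}

lemma locallyIntegrable_outgoingMajorant (hα : 0 ≤ α) (hαn : α + 1 < n) :
    LocallyIntegrable (fun z : E n => outgoingMajorant α ‖z‖) volume := by
  have hdim : 1 ≤ Module.finrank ℝ (E n) := by
    have : (1 : ℝ) < n := by linarith
    simpa using Nat.one_le_cast.1 this.le
  have hpow {β : ℝ} (hβ : β < n) : LocallyIntegrable (fun z : E n => ‖z‖ ^ (-β)) volume :=
    locallyIntegrable_of_norm_le_rpow (C := 1) hdim (by simpa using hβ)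
      (.of_forall fun z => by rw [one_mul, Real.norm_of_nonneg (by positivity)])
      (Measurable.aestronglyMeasurable (by fun_prop))
  have hderiv := hpow hαn
  rw [neg_add'] at hderiv
  exact (hpow (by linarith)).add hderiv

lemma outgoingMajorant_norm_le_bracket {X : Type*} [SeminormedAddCommGroup X] (hα : 0 ≤ α) {z : X}
    (hz : 1 ≤ ‖z‖) :
    outgoingMajorant α ‖z‖ ≤ 2 * 2 ^ (α / 2) * bracket (-α) z := by
  have hz0 : 0 < ‖z‖ := one_pos.trans_le hz
  have hle : bracket α z ≤ 2 ^ (α / 2) * ‖z‖ ^ α := by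
    rw [bracket, ← Real.sqrt_sq hz0.le, Real.sqrt_eq_rpow, ← Real.rpow_mul (by positivity),
      one_div_mul_eq_div, ← Real.mul_rpow (by norm_num) (by positivity)]
    gcongr
    rw [← Real.sqrt_eq_rpow, Real.sqrt_sq hz0.le]
    nlinarith
  have hneg : ‖z‖ ^ (-α) ≤ 2 ^ (α / 2) * bracket (-α) z := by
    rw [bracket_neg, Real.rpow_neg hz0.le, ← div_eq_mul_inv, le_div_iff₀ (bracket_pos α z),
      inv_mul_le_iff₀ (by positivity), mul_comm]
    exact hle
  have hdecay : ‖z‖ ^ (-α - 1) ≤ ‖z‖ ^ (-α) :=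
    Real.rpow_le_rpow_of_exponent_le hz (by linarith)
  rw [outgoingMajorant]
  linarith

lemma ae_ne_zero_of_one_lt (hn : (1 : ℝ) < n) : ∀ᵐ z : E n, z ≠ 0 := by
  have : Nonempty (Fin n) := ⟨⟨0, by exact_mod_cast one_pos.trans hn⟩⟩
  exact Measure.ae_ne volume 0

/-- The `i`-th partial derivative `(zᵢ / |z|) G'(|z|)` of the radial function `G(|z|)`. -/
def radialPartial (G : ℝ → ℂ) (i : Fin n) (z : E n) : ℂ :=
  ((z i / ‖z‖ : ℝ) : ℂ) * deriv G ‖z‖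

lemma abs_apply_div_le_one (z : E n) (i : Fin n) {r : ℝ} (h : ‖z‖ ≤ r) : |z i / r| ≤ 1 := by
  have hr := (norm_nonneg z).trans h
  rw [abs_div, abs_of_nonneg hr]
  exact div_le_one_of_le₀ ((PiLp.norm_apply_le z i).trans h) hr

lemma isOutgoingKernel_of_le {Γ : E n → ℂ} (hα : 0 ≤ α) (hαn : α + 1 < n) (hC : 0 ≤ C)
    (hcont : ContinuousOn Γ {0}ᶜ) (hle : ∀ z ≠ 0, ‖Γ z‖ ≤ C * outgoingMajorant α ‖z‖) :
    IsOutgoingKernel α (C * (2 * 2 ^ (α / 2))) Γ := by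
  have hmeas : Measurable Γ := measurable_of_continuousOn_compl_singleton 0 hcont
  have hne := ae_ne_zero_of_one_lt (n := n) (by linarith)
  refine ⟨hmeas, ?_, fun z hz => ?_⟩
  · have hmaj := (locallyIntegrable_outgoingMajorant hα hαn).smul C
    refine hmaj.mono hmeas.aestronglyMeasurable ?_
    filter_upwards [hne] with z hz using (hle z hz).trans (le_abs_self _)
  · calc ‖Γ z‖ ≤ C * outgoingMajorant α ‖z‖ := hle z (norm_pos_iff.1 (one_pos.trans_le hz))
      _ ≤ C * (2 * 2 ^ (α / 2) * bracket (-α) z) := by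
          gcongr
          exact outgoingMajorant_norm_le_bracket hα hz
      _ = C * (2 * 2 ^ (α / 2)) * bracket (-α) z := by ring

namespace IsOutgoingProfile

lemma nonneg (h : IsOutgoingProfile α C G) : 0 ≤ C := by
  have h1 := (norm_nonneg _).trans (h.norm_le 1 one_pos)
  rw [outgoingMajorant, Real.one_rpow, Real.one_rpow] at h1
  linarith

lemma continuousOn_deriv (h : IsOutgoingProfile α C G) : ContinuousOn (deriv G) (Set.Ioi 0) :=
  h.contDiffOn.continuousOn_deriv_of_isOpen isOpen_Ioi le_rfl

lemma isOutgoingKernel (h : IsOutgoingProfile α C G) (hα : 0 ≤ α) (hαn : α + 1 < n) :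
    IsOutgoingKernel α (C * (2 * 2 ^ (α / 2))) fun z : E n => G ‖z‖ :=
  isOutgoingKernel_of_le hα hαn h.nonneg
    (h.contDiffOn.continuousOn.comp continuous_norm.continuousOn fun _ => norm_pos_iff.2)
    fun _ hz => h.norm_le _ (norm_pos_iff.2 hz)

lemma norm_apply_div_mul_deriv_le (h : IsOutgoingProfile α C G) (hα : 0 ≤ α) {z : E n} (hz : z ≠ 0)
    (i : Fin n) {r : ℝ} (hr : ‖z‖ ≤ r) :
    ‖((z i / r : ℝ) : ℂ) * deriv G r‖ ≤ C * outgoingMajorant α ‖z‖ := by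
  have hz0 := norm_pos_iff.2 hz
  have hC := h.nonneg
  calc ‖((z i / r : ℝ) : ℂ) * deriv G r‖ = |z i / r| * ‖deriv G r‖ := by
        rw [norm_mul, Complex.norm_real, Real.norm_eq_abs]
    _ ≤ ‖deriv G r‖ := mul_le_of_le_one_left (norm_nonneg _) (abs_apply_div_le_one z i hr)
    _ ≤ C * outgoingMajorant α r := h.norm_deriv_le r (hz0.trans_le hr)
    _ ≤ C * outgoingMajorant α ‖z‖ := by gcongr; exact outgoingMajorant_anti hα hz0 hr

lemma isOutgoingKernel_radialPartial (h : IsOutgoingProfile α C G) (hα : 0 ≤ α)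
    (hαn : α + 1 < n) (i : Fin n) :
    IsOutgoingKernel α (C * (2 * 2 ^ (α / 2))) (radialPartial G i) := by
  refine isOutgoingKernel_of_le hα hαn h.nonneg (ContinuousOn.mul ?_ ?_) fun z hz => ?_
  · exact Complex.continuous_ofReal.comp_continuousOn
      (ContinuousOn.div (by fun_prop) (by fun_prop) fun z hz => norm_ne_zero_iff.2 hz)
  · exact h.continuousOn_deriv.comp continuous_norm.continuousOn fun _ => norm_pos_iff.2
  · exact h.norm_apply_div_mul_deriv_le hα hz i le_rfl

lemma hasWeakPartial_comp_norm (h : IsOutgoingProfile α C G) (hα : 0 ≤ α) (hαn : α + 1 < n)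
    (i : Fin n) : HasWeakPartial i (fun z : E n => G ‖z‖) (radialPartial G i) := by
  have hε (k : ℕ) : (0 : ℝ) < 1 / ((k : ℝ) + 1) := by positivity
  have hne := ae_ne_zero_of_one_lt (n := n) (by linarith)
  have hC := h.nonneg
  have hmaj := (locallyIntegrable_outgoingMajorant hα hαn).smul C
  have hsmooth (k : ℕ) := contDiff_comp_smoothNorm (X := E n) h.contDiffOn (hε k)
  have hfderiv (k : ℕ) (x : E n) :
      fderiv ℝ (fun x => G (smoothNorm (1 / ((k : ℝ) + 1)) x)) x (EuclideanSpace.single i 1)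
        = ((x i / smoothNorm (1 / ((k : ℝ) + 1)) x : ℝ) : ℂ)
          * deriv G (smoothNorm (1 / ((k : ℝ) + 1)) x) := by
    rw [fderiv_comp_smoothNorm_apply h.contDiffOn (hε k), EuclideanSpace.inner_single_right]
    simp
  refine hasWeakPartial_of_tendstoVaguely (fun k => hasWeakPartial_of_contDiff i (hsmooth k))
    (h.isOutgoingKernel hα hαn).locallyIntegrable
    (h.isOutgoingKernel_radialPartial hα hαn i).locallyIntegrable
    (.of_dominated (fun k => (hsmooth k).continuous.aestronglyMeasurable) hmaj (fun k => ?_) ?_)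
    (.of_dominated (fun k => (continuous_fderiv_apply (hsmooth k) _).aestronglyMeasurable) hmaj
      (fun k => ?_) ?_)
  · filter_upwards [hne] with z hz
    have hle := norm_le_smoothNorm (hε k).le z
    refine (h.norm_le _ (smoothNorm_pos (hε k) z)).trans (mul_le_mul_of_nonneg_left ?_ hC)
    exact outgoingMajorant_anti hα (norm_pos_iff.2 hz) hle
  · filter_upwards [hne] with z hz
    have hcont := h.contDiffOn.continuousOn.continuousAt (Ioi_mem_nhds (norm_pos_iff.2 hz))
    exact hcont.tendsto.comp (tendsto_smoothNorm z)
  · filter_upwards [hne] with z hz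
    rw [hfderiv]
    exact h.norm_apply_div_mul_deriv_le hα hz i (norm_le_smoothNorm (hε k).le z)
  · filter_upwards [hne] with z hz
    have hcont := h.continuousOn_deriv.continuousAt (Ioi_mem_nhds (norm_pos_iff.2 hz))
    simp_rw [hfderiv]
    refine .mul ((Complex.continuous_ofReal.tendsto _).comp ?_)
      (hcont.tendsto.comp (tendsto_smoothNorm z))
    exact tendsto_const_nhds.div (tendsto_smoothNorm z) (norm_ne_zero_iff.2 hz)

end IsOutgoingProfile

end RadialKernel

section WeakDerivativeOfConvolution

variable {n : ℕ} {α σ C : ℝ} {g : E n → ℂ}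

lemma IsOutgoingKernel.integral_smul_integral {Γ : E n → ℂ} (hΓ : IsOutgoingKernel α C Γ)
    (hg : IsSource α σ g) (hα : 0 ≤ α) (hασ : α ≤ σ) (hσ : (n : ℝ) / 2 < σ) {φ : E n → ℝ}
    (hφ : Continuous φ) (hφc : HasCompactSupport φ) :
    ∫ x, φ x • ∫ y, Γ (x - y) * g y = ∫ y, (∫ x, φ x • Γ (x - y)) * g y := by
  simp_rw [← integral_smul, ← integral_mul_const, smul_mul_assoc]
  exact integral_integral_swap (hΓ.integrable_smul_prod hg hα hασ hσ hφ hφc)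

lemma HasWeakPartial.integral_comp_sub_mul {i : Fin n} {Γ Γ' : E n → ℂ}
    (h : HasWeakPartial i Γ Γ') (hΓ : IsOutgoingKernel α C Γ) (hΓ' : IsOutgoingKernel α C Γ')
    (hg : IsSource α σ g) (hα : 0 ≤ α) (hασ : α ≤ σ) (hσ : (n : ℝ) / 2 < σ) :
    HasWeakPartial i (fun x => ∫ y, Γ (x - y) * g y) fun x => ∫ y, Γ' (x - y) * g y := by
  refine ⟨(hΓ.memWLp_integral hg hα hασ hσ).memLpLoc.locallyIntegrable one_le_two,
    (hΓ'.memWLp_integral hg hα hασ hσ).memLpLoc.locallyIntegrable one_le_two,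
    fun φ hφ hφc => ?_⟩
  rw [hΓ.integral_smul_integral hg hα hασ hσ
      (continuous_fderiv_apply (hφ.of_le (by simp)) _) (hφc.fderiv_apply ℝ _),
    hΓ'.integral_smul_integral hg hα hασ hσ hφ.continuous hφc, ← integral_neg]
  congr 1 with y
  rw [h.integral_fderiv_smul_comp_sub hφ hφc y, neg_mul]

lemma IsOutgoingProfile.memH1_integral {G : ℝ → ℂ} (h : IsOutgoingProfile α C G)
    (hg : IsSource α σ g) (hα : 0 ≤ α) (hαn : α + 1 < n) (hασ : α ≤ σ) (hσ : (n : ℝ) / 2 < σ) :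
    MemH1 (-σ) fun x => ∫ y, G ‖x - y‖ * g y := by
  have hΓ := h.isOutgoingKernel (n := n) hα hαn
  refine ⟨hΓ.memWLp_integral hg hα hασ hσ, fun i => ?_⟩
  have hΓ' := h.isOutgoingKernel_radialPartial hα hαn i
  exact ⟨_, (h.hasWeakPartial_comp_norm hα hαn i).integral_comp_sub_mul hΓ hΓ' hg hα hασ hσ,
    hΓ'.memWLp_integral hg hα hασ hσ⟩

end WeakDerivativeOfConvolution

section Mollification

variable {n : ℕ}

/-- A bump function supported in the ball of radius `1 / (k + 1)` about the origin. -/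
def bump (n k : ℕ) : ContDiffBump (0 : E n) where
  rIn := 1 / (2 * (k + 1))
  rOut := 1 / (k + 1)
  rIn_pos := by positivity
  rIn_lt_rOut := one_div_lt_one_div_of_lt (by positivity) (by linarith [k.cast_nonneg (α := ℝ)])

lemma bump_rOut_le_one (k : ℕ) : (bump n k).rOut ≤ 1 :=
  div_le_one_of_le₀ (le_add_of_nonneg_left k.cast_nonneg) (by positivity)

/-- The mollification of `u` at scale `1 / (k + 1)`. -/
def mollify (k : ℕ) (u : E n → ℝ) : E n → ℝ :=
  convolution ((bump n k).normed volume) u (ContinuousLinearMap.lsmul ℝ ℝ) volume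

lemma mollify_apply (k : ℕ) (u : E n → ℝ) (x : E n) :
    mollify k u x = ∫ y, (bump n k).normed volume (x - y) * u y := by
  rw [mollify, convolution_eq_swap]
  rfl

lemma contDiff_mollify (k : ℕ) {u : E n → ℝ} (hu : LocallyIntegrable u volume) :
    ContDiff ℝ ∞ (mollify k u) :=
  HasCompactSupport.contDiff_convolution_left _ (bump n k).hasCompactSupport_normed
    (bump n k).contDiff_normed hu

lemma fderiv_mollify_apply (k : ℕ) {u : E n → ℝ} (hu : LocallyIntegrable u volume) (x v : E n) :
    fderiv ℝ (mollify k u) x v = ∫ y, fderiv ℝ ((bump n k).normed volume) (x - y) v * u y := by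
  have hρ : ContDiff ℝ 1 ((bump n k).normed volume) := (bump n k).contDiff_normed
  have hρc : HasCompactSupport ((bump n k).normed volume) := (bump n k).hasCompactSupport_normed
  have hconv := (hρc.fderiv ℝ).convolutionExists_left
    ((ContinuousLinearMap.lsmul ℝ ℝ).precompL (E n)) (hρ.continuous_fderiv one_ne_zero) hu x
  rw [mollify, (hρc.hasFDerivAt_convolution_left _ hρ hu x).fderiv, convolution_def,
    ContinuousLinearMap.integral_apply hconv, ← integral_sub_left_eq_self _ _ x]
  simp [ContinuousLinearMap.precompL]

lemma HasWeakPartial.fderiv_mollify {i : Fin n} {u v : E n → ℝ} (h : HasWeakPartial i u v)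
    (k : ℕ) (x : E n) : fderiv ℝ (mollify k u) x (EuclideanSpace.single i 1) = mollify k v x := by
  have hρ : ContDiff ℝ ∞ ((bump n k).normed volume) := (bump n k).contDiff_normed
  have hreflect (y : E n) : fderiv ℝ (fun y => (bump n k).normed volume (x - y)) y
      (EuclideanSpace.single i 1)
        = -fderiv ℝ ((bump n k).normed volume) (x - y) (EuclideanSpace.single i 1) := by
    have hcomp : HasFDerivAt (fun y => (bump n k).normed volume (x - y)) _ y :=
      (hρ.differentiable (by simp) (x - y)).hasFDerivAt.comp y ((hasFDerivAt_id y).const_sub x)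
    rw [hcomp.fderiv]
    simp
  have hparts := h.2.2 (fun y => (bump n k).normed volume (x - y))
    (hρ.comp (contDiff_const.sub contDiff_id))
    ((bump n k).hasCompactSupport_normed.comp_homeomorph (Homeomorph.subLeft x))
  simp_rw [hreflect, smul_eq_mul, neg_mul, integral_neg] at hparts
  rw [fderiv_mollify_apply k h.1, mollify_apply]
  exact neg_injective hparts

lemma ae_tendsto_mollify {u : E n → ℝ} (hu : LocallyIntegrable u volume) :
    ∀ᵐ x, Filter.Tendsto (fun k => mollify k u x) Filter.atTop (nhds (u x)) := by
  refine ContDiffBump.ae_convolution_tendsto_right_of_locallyIntegrable (K := 2)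
    tendsto_one_div_add_atTop_nhds_zero_nat (.of_forall fun k => le_of_eq ?_) hu
  simp only [bump]
  field_simp

lemma eLpNorm_two_sq {X G : Type*} [MeasurableSpace X] [NormedAddCommGroup G] {μ : Measure X}
    (f : X → G) : eLpNorm f 2 μ ^ 2 = ∫⁻ x, ‖f x‖ₑ ^ 2 ∂μ := by
  simpa using eLpNorm_nnreal_pow_eq_lintegral (f := f) (μ := μ) (p := 2) two_ne_zero

lemma eLpNorm_mollify_le (k : ℕ) {u : E n → ℝ} (hu : AEStronglyMeasurable u volume) :
    eLpNorm (mollify k u) 2 volume ≤ eLpNorm u 2 volume := by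
  set ρ := (bump n k).normed (volume : Measure (E n))
  have hmass : ∫⁻ z, ‖ρ z‖ₑ = 1 := by
    simp_rw [ρ, Real.enorm_of_nonneg ((bump n k).nonneg_normed _)]
    rw [← ofReal_integral_eq_lintegral_ofReal (bump n k).integrable_normed
      (.of_forall (bump n k).nonneg_normed), (bump n k).integral_normed, ENNReal.ofReal_one]
  have hyoung := lintegral_conv_sq_mul_le (k := fun z => ‖ρ z‖ₑ) (g := fun y => ‖u y‖ₑ) (w := 1)
    (D := 1) (bump n k).continuous_normed.measurable.enorm hu.enorm measurable_one (by simp)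
  simp only [Pi.one_apply, mul_one, hmass, one_pow, one_mul] at hyoung
  rw [← ENNReal.pow_le_pow_left_iff two_ne_zero, eLpNorm_two_sq, eLpNorm_two_sq]
  refine (lintegral_mono fun x => ?_).trans hyoung
  gcongr
  rw [mollify_apply]
  simpa only [enorm_mul] using enorm_integral_le_lintegral_enorm fun y => ρ (x - y) * u y

lemma mollify_congr_of_eqOn_closedBall (k : ℕ) {u v : E n → ℝ} {x : E n}
    (h : Set.EqOn u v (Metric.closedBall x 1)) : mollify k u x = mollify k v x := by
  rw [mollify_apply, mollify_apply]
  refine integral_congr_ae (.of_forall fun y => ?_)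
  by_cases hy : y ∈ Metric.closedBall x 1
  · simp only [h hy]
  · have hout : x - y ∉ Function.support ((bump n k).normed (volume : Measure (E n))) := by
      rw [(bump n k).support_normed_eq, mem_ball_zero_iff, ← dist_eq_norm, dist_comm]
      exact fun hlt => hy (hlt.le.trans (bump_rOut_le_one k))
    simp only [Function.notMem_support.1 hout, zero_mul]

lemma eLpNorm_restrict_mollify_le (k : ℕ) {u : E n → ℝ} (hu : AEStronglyMeasurable u volume)
    {K : Set (E n)} (hK : IsCompact K) :
    eLpNorm (mollify k u) 2 (volume.restrict K)
      ≤ eLpNorm u 2 (volume.restrict (Metric.cthickening 1 K)) := by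
  have hK₁ : MeasurableSet (Metric.cthickening 1 K) := Metric.isClosed_cthickening.measurableSet
  have hlocal : ∀ x ∈ K,
      mollify k u x = mollify k ((Metric.cthickening 1 K).indicator u) x := fun x hx =>
    mollify_congr_of_eqOn_closedBall k fun y hy =>
      (Set.indicator_of_mem (Metric.closedBall_subset_cthickening hx 1 hy) u).symm
  rw [eLpNorm_congr_ae ((ae_restrict_mem hK.measurableSet).mono hlocal),
    ← eLpNorm_indicator_eq_eLpNorm_restrict hK₁]
  exact (eLpNorm_restrict_le ..).trans (eLpNorm_mollify_le k (hu.indicator hK₁))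

end Mollification

section ProductRule

lemma tendsto_integral_smul_of_ae_of_eLpNorm_le {X F : Type*} [MeasurableSpace X] {μ : Measure X}
    [IsFiniteMeasure μ] [NormedAddCommGroup F] [NormedSpace ℝ F] {p q C : ENNReal}
    [ENNReal.HolderTriple p q 1] (hq₁ : 1 ≤ q) (hq : q ≠ ⊤) (hC : C ≠ ⊤) {u : ℕ → X → ℝ}
    {u₀ : X → ℝ} {g : X → F} (hu : ∀ k, AEStronglyMeasurable (u k) μ)
    (hbound : ∀ k, eLpNorm (u k) p μ ≤ C) (hu₀ : MemLp u₀ p μ)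
    (hlim : ∀ᵐ x ∂μ, Filter.Tendsto (fun k => u k x) Filter.atTop (nhds (u₀ x)))
    (hg : MemLp g q μ) :
    Filter.Tendsto (fun k => ∫ x, u k x • g x ∂μ) Filter.atTop (nhds (∫ x, u₀ x • g x ∂μ)) := by
  have hint {v : X → ℝ} (hv : MemLp v p μ) : MemLp (fun x => v x • g x) 1 μ := hg.smul hv
  have hunif : UnifIntegrable (fun k x => u k x • g x) 1 μ := by
    intro ε hε
    obtain ⟨δ, hδ, hsmall⟩ := unifIntegrable_const (ι := Unit) hq₁ hq hg
      (ε := ε / (C.toReal + 1)) (by positivity)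
    refine ⟨δ, hδ, fun k s hs hμs => ?_⟩
    have hsplit : s.indicator (fun x => u k x • g x) = u k • s.indicator g := by
      ext x
      by_cases hx : x ∈ s <;> simp [hx]
    calc eLpNorm (s.indicator fun x => u k x • g x) 1 μ
        ≤ eLpNorm (u k) p μ * eLpNorm (s.indicator g) q μ := by
          rw [hsplit]
          exact eLpNorm_smul_le_mul_eLpNorm (hg.1.indicator hs) (hu k)
      _ ≤ ENNReal.ofReal (C.toReal + 1) * ENNReal.ofReal (ε / (C.toReal + 1)) := by
          gcongr
          · refine (hbound k).trans ?_
            rw [← ENNReal.ofReal_toReal hC]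
            exact ENNReal.ofReal_le_ofReal (by simp)
          · exact hsmall () s hs hμs
      _ = ENNReal.ofReal ε := by
          rw [← ENNReal.ofReal_mul (by positivity), mul_div_cancel₀ _ (by positivity)]
  have hL1 := tendsto_Lp_finite_of_tendsto_ae le_rfl ENNReal.one_ne_top
    (fun k => (hu k).smul hg.1) (hint hu₀) hunif (hlim.mono fun x hx => hx.smul_const (g x))
  refine tendsto_integral_of_L1' _ (memLp_one_iff_integrable.1 (hint hu₀)).1 (.of_forall fun k =>
    memLp_one_iff_integrable.1 (hint ⟨hu k, (hbound k).trans_lt hC.lt_top⟩)) hL1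

variable {n : ℕ} {F : Type*} [NormedAddCommGroup F] [NormedSpace ℝ F]

lemma tendstoVaguely_mollify_smul {u : E n → ℝ} {g : E n → F} (hu : MemLpLoc 2 u)
    (hg : MemLpLoc 2 g) :
    TendstoVaguely (fun k x => mollify k u x • g x) (fun x => u x • g x) := by
  intro ψ hψ hψc
  have hK : IsCompact (tsupport ψ) := hψc
  have huloc := hu.locallyIntegrable one_le_two
  have hψg : MemLp (fun x => ψ x • g x) 2 (volume.restrict (tsupport ψ)) := by
    obtain ⟨M, hM⟩ := hψ.bounded_above_of_compact_support hψc
    refine (hg hK).of_le_mul (c := M) (hψ.aestronglyMeasurable.smul (hg hK).1)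
      (.of_forall fun x => ?_)
    rw [norm_smul]
    gcongr
    exact hM x
  have hcut (v : E n → ℝ) : ∫ x, ψ x • v x • g x = ∫ x in tsupport ψ, v x • ψ x • g x := by
    rw [setIntegral_eq_integral_of_forall_compl_eq_zero fun x hx => by
      rw [image_eq_zero_of_notMem_tsupport hx, zero_smul, smul_zero]]
    simp_rw [smul_comm (ψ _)]
  have : IsFiniteMeasure (volume.restrict (tsupport ψ)) := ⟨by simpa using hK.measure_lt_top⟩
  simp_rw [hcut]
  exact tendsto_integral_smul_of_ae_of_eLpNorm_le (p := 2) one_le_two ENNReal.ofNat_ne_top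
    (hu hK.cthickening).2.ne
    (fun k => (contDiff_mollify k huloc).continuous.aestronglyMeasurable)
    (fun k => eLpNorm_restrict_mollify_le k huloc.aestronglyMeasurable hK) (hu hK)
    (ae_restrict_of_ae (ae_tendsto_mollify huloc)) hψg

lemma HasWeakPartial.smul {i : Fin n} {w dw : E n → ℝ} {f g : E n → F}
    (hw : HasWeakPartial i w dw) (hf : HasWeakPartial i f g) (hw₂ : MemLpLoc 2 w)
    (hdw₂ : MemLpLoc 2 dw) (hf₂ : MemLpLoc 2 f) (hg₂ : MemLpLoc 2 g) :
    HasWeakPartial i (fun x => w x • f x) (fun x => dw x • f x + w x • g x) := by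
  have hloc {a : E n → ℝ} {b : E n → F} (ha : MemLpLoc 2 a) (hb : MemLpLoc 2 b) :
      LocallyIntegrable (fun x => a x • b x) volume := (ha.smul hb).locallyIntegrable le_rfl
  have happrox (k : ℕ) := hf.contDiff_smul (contDiff_mollify k hw.1)
  simp_rw [hw.fderiv_mollify] at happrox
  exact hasWeakPartial_of_tendstoVaguely happrox (hloc hw₂ hf₂)
    ((hloc hdw₂ hf₂).add (hloc hw₂ hg₂)) (tendstoVaguely_mollify_smul hw₂ hf₂)
    ((tendstoVaguely_mollify_smul hdw₂ hf₂).add (tendstoVaguely_mollify_smul hw₂ hg₂)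
      (fun k => locallyIntegrable_continuous_smul hf.1 (contDiff_mollify k hw.2.1).continuous)
      (fun k => locallyIntegrable_continuous_smul hf.2.1 (contDiff_mollify k hw.1).continuous)
      (hloc hdw₂ hf₂) (hloc hw₂ hg₂))

end ProductRule

section SobolevInequality

variable {n : ℕ}

/-- The Sobolev inequality `‖u‖_q ≤ C (‖u‖₂ + ‖∇u‖₂)` for compactly supported `C¹` functions. -/
def SobolevExponent (n : ℕ) (q : ENNReal) : Prop :=
  ∃ C : ENNReal, C ≠ ⊤ ∧ ∀ u : E n → ℝ, ContDiff ℝ 1 u → HasCompactSupport u →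
    eLpNorm u q volume ≤ C * (eLpNorm u 2 volume + eLpNorm (fderiv ℝ u) 2 volume)

lemma sobolevExponent_of_inv_eq (hn : 0 < n) {q : NNReal} (hq : (q : ℝ)⁻¹ = 2⁻¹ - (n : ℝ)⁻¹) :
    SobolevExponent n q := by
  refine ⟨eLpNormLESNormFDerivOfEqInnerConst (volume : Measure (E n)) 2, ENNReal.coe_ne_top,
    fun u hu huc => ?_⟩
  refine (eLpNorm_le_eLpNorm_fderiv_of_eq_inner volume hu huc (p := 2) one_le_two
    (by simpa using hn) (by simpa using hq)).trans (mul_le_mul_right ?_ _)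
  exact_mod_cast le_add_self

-- The Gagliardo–Nirenberg–Sobolev inequality for `p = 1`, whose target exponent in the plane is
-- `2`, applied to `u ^ (m + 1)`.
lemma eLpNorm_pow_succ_le {u : E 2 → ℝ} (hu : ContDiff ℝ 1 u) (huc : HasCompactSupport u)
    (m : ℕ) :
    eLpNorm (fun x => u x ^ (m + 1)) 2 volume
      ≤ eLpNormLESNormFDerivOneConst (volume : Measure (E 2)) 2 * ((m + 1 : ℕ) *
        (eLpNorm (fun x => u x ^ m) 2 volume * eLpNorm (fderiv ℝ u) 2 volume)) := by
  have hconj : NNReal.HolderConjugate (Module.finrank ℝ (E 2)) 2 := by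
    rw [finrank_euclideanSpace_fin, NNReal.holderConjugate_iff]
    exact ⟨by norm_num, NNReal.coe_injective (by norm_num)⟩
  have hfderiv (x : E 2) : ‖fderiv ℝ (fun x => u x ^ (m + 1)) x‖
      ≤ (m + 1 : ℕ) * ‖u x ^ m • fderiv ℝ u x‖ := by
    rw [fderiv_fun_pow _ (hu.differentiable one_ne_zero x), Nat.add_sub_cancel, nsmul_eq_mul,
      mul_smul, norm_smul, Real.norm_natCast]
  have hgns := eLpNorm_le_eLpNorm_fderiv_one volume (hu.pow (m + 1))
    (huc.comp_left (g := (· ^ (m + 1))) (zero_pow m.succ_ne_zero)) hconj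
  rw [ENNReal.coe_ofNat, NNReal.coe_ofNat] at hgns
  refine hgns.trans (mul_le_mul_right ?_ _)
  refine (eLpNorm_le_mul_eLpNorm_of_ae_le_mul (.of_forall hfderiv) 1).trans ?_
  rw [ENNReal.ofReal_natCast]
  have hholder : eLpNorm ((fun x => u x ^ m) • fderiv ℝ u) 1 volume
      ≤ eLpNorm (fun x => u x ^ m) 2 volume * eLpNorm (fderiv ℝ u) 2 volume :=
    eLpNorm_smul_le_mul_eLpNorm
      (hu.continuous_fderiv one_ne_zero).aestronglyMeasurable
      (hu.continuous.pow m).aestronglyMeasurable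
  exact mul_le_mul_right hholder _

lemma exists_eLpNorm_pow_le (m : ℕ) : ∃ C : ENNReal, C ≠ ⊤ ∧ ∀ u : E 2 → ℝ,
    ContDiff ℝ 1 u → HasCompactSupport u → eLpNorm (fun x => u x ^ (m + 1)) 2 volume
      ≤ C * (eLpNorm u 2 volume + eLpNorm (fderiv ℝ u) 2 volume) ^ (m + 1) := by
  induction m with
  | zero => exact ⟨1, ENNReal.one_ne_top, fun u _ _ => by simp⟩
  | succ m ih =>
    obtain ⟨C, hC, hbound⟩ := ih
    set K : ENNReal := ↑(eLpNormLESNormFDerivOneConst (volume : Measure (E 2)) 2)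
    refine ⟨K * ((m + 1 + 1 : ℕ) * C), by finiteness, fun u hu huc => ?_⟩
    set N := eLpNorm u 2 volume + eLpNorm (fderiv ℝ u) 2 volume
    calc eLpNorm (fun x => u x ^ (m + 1 + 1)) 2 volume
        ≤ K * ((m + 1 + 1 : ℕ) * (eLpNorm (fun x => u x ^ (m + 1)) 2 volume
          * eLpNorm (fderiv ℝ u) 2 volume)) := eLpNorm_pow_succ_le hu huc (m + 1)
      _ ≤ K * ((m + 1 + 1 : ℕ) * (C * N ^ (m + 1) * N)) := by
        gcongr
        · exact hbound u hu huc
        · exact le_add_of_nonneg_left zero_le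
      _ = K * ((m + 1 + 1 : ℕ) * C) * N ^ (m + 1 + 1) := by ring

lemma sobolevExponent_dim_two (m : ℕ) : SobolevExponent 2 (2 * (m + 1 : ℕ)) := by
  obtain ⟨C, hC, hbound⟩ := exists_eLpNorm_pow_le m
  have hm : (0 : ℝ) < (m + 1 : ℕ) := by positivity
  refine ⟨C ^ ((m + 1 : ℕ) : ℝ)⁻¹, by finiteness, fun u hu huc => ?_⟩
  have hpow : eLpNorm (fun x => u x ^ (m + 1)) 2 volume
      = eLpNorm u (2 * (m + 1 : ℕ)) volume ^ ((m + 1 : ℕ) : ℝ) := by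
    rw [← ENNReal.ofReal_natCast, ← eLpNorm_norm_rpow u hm]
    refine eLpNorm_congr_norm_ae (.of_forall fun x => ?_)
    rw [Real.rpow_natCast, norm_pow, norm_pow, norm_norm]
  rw [← ENNReal.rpow_le_rpow_iff hm, ENNReal.mul_rpow_of_nonneg _ _ hm.le, ← ENNReal.rpow_mul,
    inv_mul_cancel₀ hm.ne', ENNReal.rpow_one, ← hpow, ENNReal.rpow_natCast]
  exact hbound u hu huc

end SobolevInequality

section SobolevEmbedding

variable {n : ℕ}

lemma norm_clm_le_sum (L : E n →L[ℝ] ℝ) : ‖L‖ ≤ ∑ i, ‖L (EuclideanSpace.single i 1)‖ := by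
  refine L.opNorm_le_bound (Finset.sum_nonneg fun i _ => norm_nonneg _) fun z => ?_
  have hz : z = ∑ i, z i • EuclideanSpace.single i (1 : ℝ) := by
    ext j
    simp [Finset.sum_apply, Pi.single_apply]
  calc ‖L z‖ = ‖∑ i, z i • L (EuclideanSpace.single i 1)‖ := by
        conv_lhs => rw [hz]
        simp only [map_sum, map_smul]
    _ ≤ ∑ i, ‖z i‖ * ‖L (EuclideanSpace.single i 1)‖ := by
        simpa only [norm_smul] using norm_sum_le Finset.univ fun i =>
          z i • L (EuclideanSpace.single i 1)
    _ ≤ ∑ i, ‖z‖ * ‖L (EuclideanSpace.single i 1)‖ := by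
        gcongr with i
        exact PiLp.norm_apply_le z i
    _ = (∑ i, ‖L (EuclideanSpace.single i 1)‖) * ‖z‖ := by rw [← Finset.mul_sum, mul_comm]

lemma eLpNorm_fderiv_mollify_le (k : ℕ) {u : E n → ℝ} {v : Fin n → E n → ℝ}
    (h : ∀ i, HasWeakPartial i u (v i)) :
    eLpNorm (fderiv ℝ (mollify k u)) 2 volume ≤ ∑ i, eLpNorm (v i) 2 volume := by
  have hpoint (x : E n) : ‖fderiv ℝ (mollify k u) x‖ ≤ (∑ i, fun x => ‖mollify k (v i) x‖) x := by
    simpa only [Finset.sum_apply, (h _).fderiv_mollify] using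
      norm_clm_le_sum (fderiv ℝ (mollify k u) x)
  calc eLpNorm (fderiv ℝ (mollify k u)) 2 volume
      ≤ eLpNorm (∑ i, fun x => ‖mollify k (v i) x‖) 2 volume := eLpNorm_mono_real hpoint
    _ ≤ ∑ i, eLpNorm (fun x => ‖mollify k (v i) x‖) 2 volume :=
        eLpNorm_sum_le (fun i _ =>
          (contDiff_mollify k (h i).2.1).continuous.norm.aestronglyMeasurable) one_le_two
    _ ≤ ∑ i, eLpNorm (v i) 2 volume := by
        gcongr with i
        rw [eLpNorm_norm]
        exact eLpNorm_mollify_le k (h i).2.1.aestronglyMeasurable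

/-- A smooth cutoff, equal to `1` on the unit ball. -/
def unitCutoff (n : ℕ) : ContDiffBump (0 : E n) := ⟨1, 2, one_pos, one_lt_two⟩

/-- The mollification of `u` at scale `1 / (k + 1)`, cut off at radius `k + 1`. -/
def testApprox (k : ℕ) (u : E n → ℝ) (x : E n) : ℝ :=
  unitCutoff n ((k + 1 : ℝ)⁻¹ • x) * mollify k u x

lemma contDiff_unitCutoff_smul (c : ℝ) : ContDiff ℝ ∞ fun x : E n => unitCutoff n (c • x) :=
  (unitCutoff n).contDiff.comp (contDiff_const_smul c)

lemma norm_unitCutoff_le_one (x : E n) : ‖unitCutoff n x‖ ≤ 1 := by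
  rw [Real.norm_of_nonneg (unitCutoff n).nonneg]
  exact (unitCutoff n).le_one

lemma exists_norm_fderiv_unitCutoff_smul_le (n : ℕ) : ∃ M : ℝ, ∀ c : ℝ, |c| ≤ 1 → ∀ x : E n,
    ‖fderiv ℝ (fun x => unitCutoff n (c • x)) x‖ ≤ M := by
  have hsmooth : ContDiff ℝ 1 (unitCutoff n) := (unitCutoff n).contDiff
  obtain ⟨M, hM⟩ := (hsmooth.continuous_fderiv one_ne_zero).bounded_above_of_compact_support
    ((unitCutoff n).hasCompactSupport.fderiv ℝ)
  refine ⟨M, fun c hc x => ?_⟩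
  rw [fderiv_comp_smul, norm_smul]
  exact (mul_le_of_le_one_left (norm_nonneg _) hc).trans (hM _)

lemma tendsto_unitCutoff_smul (x : E n) :
    Filter.Tendsto (fun k : ℕ => unitCutoff n ((k + 1 : ℝ)⁻¹ • x)) Filter.atTop (nhds 1) := by
  obtain ⟨N, hN⟩ := exists_nat_ge ‖x‖
  refine tendsto_const_nhds.congr' ?_
  filter_upwards [Filter.eventually_ge_atTop N] with k hk
  refine ((unitCutoff n).one_of_mem_closedBall ?_).symm
  have hNk : (N : ℝ) ≤ k := by exact_mod_cast hk
  rw [mem_closedBall_zero_iff, norm_smul, Real.norm_of_nonneg (by positivity),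
    inv_mul_le_iff₀ (by positivity), unitCutoff]
  linarith

lemma contDiff_testApprox (k : ℕ) {u : E n → ℝ} (hu : LocallyIntegrable u volume) :
    ContDiff ℝ ∞ (testApprox k u) :=
  (contDiff_unitCutoff_smul _).mul (contDiff_mollify k hu)

lemma hasCompactSupport_testApprox (k : ℕ) (u : E n → ℝ) : HasCompactSupport (testApprox k u) :=
  ((unitCutoff n).hasCompactSupport.comp_smul (by positivity)).mul_right

lemma ae_tendsto_testApprox {u : E n → ℝ} (hu : LocallyIntegrable u volume) :
    ∀ᵐ x, Filter.Tendsto (fun k => testApprox k u x) Filter.atTop (nhds (u x)) := by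
  filter_upwards [ae_tendsto_mollify hu] with x hx
  simpa only [testApprox, one_mul] using (tendsto_unitCutoff_smul x).mul hx

lemma eLpNorm_testApprox_le (k : ℕ) {u : E n → ℝ} (hu : AEStronglyMeasurable u volume) :
    eLpNorm (testApprox k u) 2 volume ≤ eLpNorm u 2 volume := by
  refine (eLpNorm_mono fun x => ?_).trans (eLpNorm_mollify_le k hu)
  rw [testApprox, norm_mul]
  exact mul_le_of_le_one_left (norm_nonneg _) (norm_unitCutoff_le_one _)

lemma exists_eLpNorm_fderiv_testApprox_le (n : ℕ) : ∃ M : ℝ, ∀ (k : ℕ) (u : E n → ℝ)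
    (v : Fin n → E n → ℝ), (∀ i, HasWeakPartial i u (v i)) → LocallyIntegrable u volume →
      eLpNorm (fderiv ℝ (testApprox k u)) 2 volume
        ≤ ∑ i, eLpNorm (v i) 2 volume + ENNReal.ofReal M * eLpNorm u 2 volume := by
  obtain ⟨M, hM⟩ := exists_norm_fderiv_unitCutoff_smul_le n
  refine ⟨M, fun k u v h hu => ?_⟩
  set χ : E n → ℝ := fun x => unitCutoff n ((k + 1 : ℝ)⁻¹ • x)
  have hχ : ContDiff ℝ ∞ χ := contDiff_unitCutoff_smul _
  have hχM (x : E n) : ‖fderiv ℝ χ x‖ ≤ M := by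
    refine hM _ ?_ x
    rw [abs_of_nonneg (by positivity)]
    exact inv_le_one_of_one_le₀ (le_add_of_nonneg_left k.cast_nonneg)
  have hmol := contDiff_mollify k hu
  have hleibniz : fderiv ℝ (testApprox k u)
      = (fun x => χ x • fderiv ℝ (mollify k u) x) + fun x => mollify k u x • fderiv ℝ χ x :=
    funext fun x => fderiv_fun_mul (hχ.differentiable (by simp) x) (hmol.differentiable (by simp) x)
  rw [hleibniz]
  refine (eLpNorm_add_le
    (hχ.continuous.smul (hmol.continuous_fderiv (by simp))).aestronglyMeasurable
    (hmol.continuous.smul (hχ.continuous_fderiv (by simp))).aestronglyMeasurable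
    one_le_two).trans (add_le_add ?_ ?_)
  · refine (eLpNorm_mono fun x => ?_).trans (eLpNorm_fderiv_mollify_le k h)
    change ‖χ x • fderiv ℝ (mollify k u) x‖ ≤ _
    rw [norm_smul]
    exact mul_le_of_le_one_left (norm_nonneg _) (norm_unitCutoff_le_one _)
  · refine (eLpNorm_le_mul_eLpNorm_of_ae_le_mul (c := M) (.of_forall fun x => ?_) 2).trans
      (mul_le_mul_right (eLpNorm_mollify_le k hu.aestronglyMeasurable) _)
    change ‖mollify k u x • fderiv ℝ χ x‖ ≤ _
    rw [norm_smul, mul_comm]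
    gcongr
    exact hχM x

lemma SobolevExponent.memLp {q : ENNReal} (hq : SobolevExponent n q) {u : E n → ℝ}
    {v : Fin n → E n → ℝ} (hu : MemLp u 2 volume) (hv : ∀ i, MemLp (v i) 2 volume)
    (h : ∀ i, HasWeakPartial i u (v i)) : MemLp u q volume := by
  obtain ⟨C, hC, hsob⟩ := hq
  obtain ⟨M, hM⟩ := exists_eLpNorm_fderiv_testApprox_le n
  have huloc := hu.locallyIntegrable one_le_two
  have hbound (k : ℕ) : eLpNorm (testApprox k u) q volume ≤ C * (eLpNorm u 2 volume
      + (∑ i, eLpNorm (v i) 2 volume + ENNReal.ofReal M * eLpNorm u 2 volume)) := by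
    refine (hsob _ ((contDiff_testApprox k huloc).of_le (by simp))
      (hasCompactSupport_testApprox k u)).trans ?_
    gcongr
    · exact eLpNorm_testApprox_le k hu.1
    · exact hM k u v h huloc
  have hfatou := Lp.eLpNorm_lim_le_liminf_eLpNorm (p := q)
    (fun k => (contDiff_testApprox k huloc).continuous.aestronglyMeasurable) u
    (ae_tendsto_testApprox huloc)
  refine ⟨hu.1, (hfatou.trans (Filter.liminf_le_of_frequently_le'
    (Filter.Frequently.of_forall hbound))).trans_lt ?_⟩
  have hu_fin := hu.2.ne
  have hv_fin := (ENNReal.sum_lt_top.2 fun i (_ : i ∈ Finset.univ) => (hv i).2).ne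
  finiteness

lemma SobolevExponent.memLp_complex {q : ENNReal} (hq : SobolevExponent n q) {u : E n → ℂ}
    {v : Fin n → E n → ℂ} (hu : MemLp u 2 volume) (hv : ∀ i, MemLp (v i) 2 volume)
    (h : ∀ i, HasWeakPartial i u (v i)) : MemLp u q volume := by
  have hcomponent (L : ℂ →L[ℝ] ℝ) : MemLp (fun x => L (u x)) q volume :=
    hq.memLp (L.comp_memLp' hu) (fun i => L.comp_memLp' (hv i)) (fun i => (h i).clm_comp L)
  exact memLp_re_im_iff.1 ⟨hcomponent Complex.reCLM, hcomponent Complex.imCLM⟩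

lemma memLp_of_exponent_between {X F : Type*} [MeasurableSpace X] {μ : Measure X}
    [NormedAddCommGroup F] {f : X → F} {p q r : ENNReal} (hp : p ≠ 0) (hr : r ≠ ⊤)
    (hpq : p ≤ q) (hqr : q ≤ r) (hfp : MemLp f p μ) (hfr : MemLp f r μ) : MemLp f q μ := by
  have hq : q ≠ ⊤ := ne_top_of_le_ne_top hr hqr
  have hp_top : p ≠ ⊤ := ne_top_of_le_ne_top hq hpq
  have hq0 : q ≠ 0 := (hp.bot_lt.trans_le hpq).ne'
  have hr0 : r ≠ 0 := (hq0.bot_lt.trans_le hqr).ne'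
  refine ⟨hfp.1, ?_⟩
  rw [eLpNorm_lt_top_iff_lintegral_rpow_enorm_lt_top hq0 hq]
  calc ∫⁻ x, ‖f x‖ₑ ^ q.toReal ∂μ
      ≤ ∫⁻ x, (‖f x‖ₑ ^ p.toReal + ‖f x‖ₑ ^ r.toReal) ∂μ := by
        refine lintegral_mono fun x => ?_
        rcases le_total ‖f x‖ₑ 1 with h | h
        · exact (ENNReal.rpow_le_rpow_of_exponent_ge h
            (ENNReal.toReal_mono hq hpq)).trans le_self_add
        · exact (ENNReal.rpow_le_rpow_of_exponent_le h
            (ENNReal.toReal_mono hr hqr)).trans le_add_self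
    _ = ∫⁻ x, ‖f x‖ₑ ^ p.toReal ∂μ + ∫⁻ x, ‖f x‖ₑ ^ r.toReal ∂μ :=
        lintegral_add_left' (hfp.1.enorm.pow_const _) _
    _ < ⊤ := ENNReal.add_lt_top.2
        ⟨(eLpNorm_lt_top_iff_lintegral_rpow_enorm_lt_top hp hp_top).1 hfp.2,
          (eLpNorm_lt_top_iff_lintegral_rpow_enorm_lt_top hr0 hr).1 hfr.2⟩

end SobolevEmbedding

section MultiplicationBySobolevFunctions

variable {n : ℕ} {p : ENNReal}

lemma MemWLp.memLp_fderiv_bracket_smul_add {F : Type*} [NormedAddCommGroup F] [NormedSpace ℝ F]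
    {q : ENNReal} {σ : ℝ} {f g : E n → F} (hf : MemWLp q σ f) (hg : MemWLp q σ g) (v : E n) :
    MemLp (fun x => fderiv ℝ (bracket σ) x v • f x + bracket σ x • g x) q volume := by
  refine MemLp.add ?_ (memWLp_iff.1 hg)
  refine MemLp.of_le_mul (c := |σ| * ‖v‖) (memWLp_iff.1 hf)
    ((continuous_fderiv_apply ((contDiff_bracket σ).of_le (by simp)) v).aestronglyMeasurable.smul
      hf.aestronglyMeasurable) (.of_forall fun x => ?_)
  calc ‖fderiv ℝ (bracket σ) x v • f x‖ ≤ |σ| * bracket σ x * ‖v‖ * ‖f x‖ := by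
        rw [norm_smul]
        gcongr
        exact abs_fderiv_bracket_le σ x v
    _ = |σ| * ‖v‖ * ‖bracket σ x • f x‖ := by
        rw [norm_smul, norm_bracket]
        ring

lemma MemH1.memWLp {σ : ℝ} {f : E n → ℂ} {q Q : ENNReal} (hf : MemH1 σ f)
    (hQ : SobolevExponent n Q) (hQ_top : Q ≠ ⊤) (hq : 2 ≤ q) (hqQ : q ≤ Q) : MemWLp q σ f := by
  obtain ⟨hf₂, hgrad⟩ := hf
  choose g hfg hg using hgrad
  refine memLp_of_exponent_between two_ne_zero hQ_top hq hqQ (memWLp_iff.1 hf₂) ?_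
  exact hQ.memLp_complex (memWLp_iff.1 hf₂) (fun i => hf₂.memLp_fderiv_bracket_smul_add (hg i) _)
    fun i => (hfg i).contDiff_smul (contDiff_bracket σ)

lemma ExponentOK.two_lt (hp : ExponentOK n p) : 2 < p := by
  rcases hp with ⟨-, h⟩ | ⟨-, h⟩
  · exact lt_of_lt_of_le (by norm_num) h
  · exact h

lemma two_le_inv_half_sub (hp : 2 < p) : 2 ≤ (1 / 2 - (p⁻¹).toReal)⁻¹ := by
  rw [le_inv_comm₀ two_pos (sub_pos.2 (toReal_inv_lt_half hp)), ← one_div (2 : ℝ)]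
  exact sub_le_self _ ENNReal.toReal_nonneg

lemma ExponentOK.exists_sobolevExponent (hp : ExponentOK n p) : ∃ Q : ENNReal,
    ENNReal.ofReal (1 / 2 - (p⁻¹).toReal)⁻¹ ≤ Q ∧ Q ≠ ⊤ ∧ SobolevExponent n Q := by
  rcases hp with ⟨rfl, h⟩ | ⟨rfl, -⟩
  · refine ⟨(6 : NNReal), ?_, ENNReal.coe_ne_top,
      sobolevExponent_of_inv_eq (by norm_num) (by norm_num)⟩
    have hinv : (p⁻¹).toReal ≤ 1 / 3 := by
      simpa using ENNReal.toReal_mono (by simp) (ENNReal.inv_le_inv.2 h)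
    refine ENNReal.ofReal_le_of_le_toReal ((inv_anti₀ (by norm_num : (0 : ℝ) < 1 / 6)
      (by linarith)).trans (by norm_num))
  · obtain ⟨m, hm⟩ := exists_nat_ge (1 / 2 - (p⁻¹).toReal)⁻¹
    refine ⟨2 * (m + 1 : ℕ), ?_, by finiteness, sobolevExponent_dim_two m⟩
    refine ENNReal.ofReal_le_of_le_toReal (hm.trans ?_)
    rw [ENNReal.toReal_mul, ENNReal.toReal_ofNat, ENNReal.toReal_natCast, Nat.cast_succ]
    linarith [m.cast_nonneg (α := ℝ)]

lemma MemH1.smul (hp : ExponentOK n p) {σ s : ℝ} (hs : 0 ≤ s) {A : E n → ℝ} (hA : MemWLp p s A)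
    {f : E n → ℂ} (hf : MemH1 σ f) : MemWLp 2 σ fun x => A x • f x := by
  obtain ⟨Q, hQ, hQ_top, hsob⟩ := hp.exists_sobolevExponent
  have := holderTriple_two hp.two_lt
  have htwo : (2 : ENNReal) ≤ ENNReal.ofReal (1 / 2 - (p⁻¹).toReal)⁻¹ := by
    simpa using ENNReal.ofReal_le_ofReal (two_le_inv_half_sub hp.two_lt)
  exact (hA.smul (hf.memWLp hsob hQ_top htwo hQ)).mono (le_add_of_nonneg_left hs)

end MultiplicationBySobolevFunctions

section PlaneWave

variable {n : ℕ} {σ : ℝ}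

lemma memWLp_two_of_bounded {F : Type*} [NormedAddCommGroup F] [NormedSpace ℝ F] {f : E n → F}
    {C : ℝ} (hσ : n / 2 < σ) (hf : AEStronglyMeasurable f volume) (hC : ∀ x, ‖f x‖ ≤ C) :
    MemWLp 2 (-σ) f := by
  have hbounded : MemWLp ⊤ 0 f := by
    simpa [memWLp_iff, bracket_zero] using memLp_top_of_bound hf C (.of_forall hC)
  refine hbounded.two_of_lt (by simp) ?_
  rw [ENNReal.inv_top, ENNReal.toReal_zero]
  linarith

lemma norm_planeWave (k : ℝ) (θ x : E n) : ‖planeWave k θ x‖ = 1 :=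
  norm_exp_I_mul_ofReal _

lemma planeWave_eq_cexp (k : ℝ) (θ : E n) :
    planeWave k θ = fun x => Complex.exp ((k • innerSL ℝ θ).smulRight Complex.I x) := by
  ext x
  simp [planeWave, real_inner_comm, mul_comm]

lemma contDiff_planeWave (k : ℝ) (θ : E n) : ContDiff ℝ 1 (planeWave k θ) := by
  rw [planeWave_eq_cexp]
  exact (ContinuousLinearMap.contDiff _).cexp

lemma hasFDerivAt_planeWave (k : ℝ) (θ x : E n) : HasFDerivAt (planeWave k θ)
    (planeWave k θ x • (k • innerSL ℝ θ).smulRight Complex.I) x := by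
  rw [planeWave_eq_cexp]
  exact (ContinuousLinearMap.hasFDerivAt _).cexp

lemma memH1_planeWave (hσ : n / 2 < σ) (k : ℝ) (θ : E n) : MemH1 (-σ) (planeWave k θ) := by
  have hsmooth := contDiff_planeWave k θ
  refine ⟨memWLp_two_of_bounded hσ hsmooth.continuous.aestronglyMeasurable
    fun x => (norm_planeWave k θ x).le, fun i => ⟨_, hasWeakPartial_of_contDiff i hsmooth,
      memWLp_two_of_bounded hσ (continuous_fderiv_apply hsmooth _).aestronglyMeasurable
        (C := ‖(k • innerSL ℝ θ).smulRight Complex.I‖) fun x => ?_⟩⟩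
  rw [(hasFDerivAt_planeWave k θ x).fderiv, _root_.smul_apply, norm_smul, norm_planeWave, one_mul]
  refine (ContinuousLinearMap.le_opNorm _ _).trans_eq ?_
  rw [PiLp.norm_single, norm_one, mul_one]

end PlaneWave

section Source

variable {n : ℕ}

namespace IsSource

variable {α σ : ℝ} {g h : E n → ℂ}

lemma congr (hg : IsSource α σ g) (hgh : g =ᵐ[volume] h) : IsSource α σ h :=
  ⟨hg.memWLp_one.congr hgh, hg.memWLp_two.congr hgh⟩

lemma add (hg : IsSource α σ g) (hh : IsSource α σ h) : IsSource α σ fun x => g x + h x :=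
  ⟨hg.memWLp_one.add hh.memWLp_one, hg.memWLp_two.add hh.memWLp_two⟩

lemma const_mul (hg : IsSource α σ g) (c : ℂ) : IsSource α σ fun x => c * g x := by
  have hmeas := hg.aestronglyMeasurable.const_mul c
  have hle : ∀ᵐ x, ‖c * g x‖ ≤ ‖c‖ * ‖g x‖ := .of_forall fun x => norm_mul_le _ _
  exact ⟨hg.memWLp_one.of_le le_rfl hmeas hle, hg.memWLp_two.of_le le_rfl hmeas hle⟩

lemma sum {ι : Type*} (s : Finset ι) {g : ι → E n → ℂ} (hg : ∀ i ∈ s, IsSource α σ (g i)) :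
    IsSource α σ fun x => ∑ i ∈ s, g i x := by
  classical
  induction s using Finset.induction_on with
  | empty => constructor <;> simp [memWLp_iff]
  | insert i s hi ih =>
    simp_rw [Finset.sum_insert hi]
    exact (hg i (Finset.mem_insert_self i s)).add
      (ih fun j hj => hg j (Finset.mem_insert_of_mem hj))

end IsSource

lemma ExponentOK.dim {p : ENNReal} (hp : ExponentOK n p) : n = 2 ∨ n = 3 :=
  hp.symm.imp And.left And.left

lemma weightBound_nonneg {p : ENNReal} (hp : 2 < p) : 0 ≤ weightBound n p := by
  have hle : n * (p⁻¹).toReal ≤ n * (1 / 2) :=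
    mul_le_mul_of_nonneg_left (toReal_inv_lt_half hp).le n.cast_nonneg
  rw [weightBound]
  linarith

section Multiplication

variable {p : ENNReal} {ε s : ℝ} {A : E n → ℝ} {f : E n → ℂ}

lemma MemWLp.smul_one_of_weightBound_lt (hp : 2 < p) (hs : weightBound n p + ε < s)
    (hA : MemWLp p s A) (hf : MemWLp 2 (-(n / 2 + ε)) f) :
    MemWLp 1 (-((n - 1) / 2)) fun x => A x • f x := by
  refine hA.smul_one_of_lt hp hf ?_
  rw [weightBound] at hs
  linarith

lemma IsSource.smul_of_memH1 (hp : ExponentOK n p) (hε : 0 < ε) (hs : weightBound n p + ε < s)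
    (hA : MemWLp p s A) (hf : MemH1 (-(n / 2 + ε)) f) :
    IsSource ((n - 1) / 2) (n / 2 + ε) fun x => A x • f x :=
  ⟨hA.smul_one_of_weightBound_lt hp.two_lt hs hf.1,
    hf.smul hp (by linarith [weightBound_nonneg (n := n) hp.two_lt]) hA⟩

lemma IsSource.smul_of_memWLp_top (hε : 0 < ε) (hs : weightBound n ⊤ + ε < s)
    (hA : MemWLp ⊤ s A) (hf : MemWLp 2 (-(n / 2 + ε)) f) :
    IsSource ((n - 1) / 2) (n / 2 + ε) fun x => A x • f x :=
  have htop : (2 : ENNReal) < ⊤ := by simp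
  ⟨hA.smul_one_of_weightBound_lt htop hs hf,
    (hA.smul (r := 2) hf).mono (by linarith [weightBound_nonneg (n := n) htop])⟩

end Multiplication

lemma MemWLp.apply {p : ENNReal} {s : ℝ} {W : E n → E n} (hW : MemWLp p s W) (i : Fin n) :
    MemWLp p s fun x => W x i :=
  hW.of_le (C := 1) le_rfl
    ((EuclideanSpace.proj (𝕜 := ℝ) i).continuous.comp_aestronglyMeasurable hW.aestronglyMeasurable)
    (.of_forall fun x => by simpa using PiLp.norm_apply_le (W x) i)

lemma MemWLp.norm_sq_top {s : ℝ} {W : E n → E n} (hs : 0 ≤ s) (hW : MemWLp ⊤ s W) :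
    MemWLp ⊤ s fun x => ‖W x‖ ^ 2 := by
  have hnorm : MemWLp ⊤ s fun x => ‖W x‖ :=
    hW.of_le (C := 1) le_rfl hW.aestronglyMeasurable.norm (by simp)
  simpa only [sq, smul_eq_mul] using
    (hnorm.smul (r := ⊤) hnorm).mono (le_add_of_nonneg_left hs)

variable {p₁ p₂ : ENNReal} {δ δ₁ δ₂ ε σ : ℝ} {W : E n → E n} {V : E n → ℝ} {f : E n → ℂ}

lemma hasWeakPartial_component_mul {g : E n → ℂ} {dW : E n → E n} {i : Fin n} (hp₁ : 2 ≤ p₁)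
    (hW : MemWLp ⊤ δ W) (hWdW : HasWeakPartial i W dW) (hdW : MemWLp p₁ δ₁ dW)
    (hf : MemWLp 2 σ f) (hg : MemWLp 2 σ g) (hfg : HasWeakPartial i f g) :
    HasWeakPartial i (fun x => (W x i : ℂ) * f x) (fun x => dW x i • f x + W x i • g x) :=
  (hWdW.clm_comp (EuclideanSpace.proj (𝕜 := ℝ) i)).smul hfg
    ((hW.apply i).memLpLoc.mono_exponent le_top) ((hdW.apply i).memLpLoc.mono_exponent hp₁)
    hf.memLpLoc hg.memLpLoc

lemma source_ae_eq {g : Fin n → E n → ℂ} {dW : Fin n → E n → E n} (hp₁ : 2 ≤ p₁)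
    (hW : MemWLp ⊤ δ W) (hWdW : ∀ i, HasWeakPartial i W (dW i)) (hdW : ∀ i, MemWLp p₁ δ₁ (dW i))
    (hf : MemWLp 2 σ f) (hg : ∀ i, MemWLp 2 σ (g i)) (hfg : ∀ i, HasWeakPartial i f (g i)) :
    source W V f =ᵐ[volume] fun x => Complex.I * ∑ i, (dW i x i • f x + W x i • g i x)
      + Complex.I * ∑ i, W x i • g i x + -1 * (‖W x‖ ^ 2 • f x + V x • f x) := by
  have hgrad : ∀ᵐ x, ∀ i, weakPartial i f x = g i x :=
    ae_all_iff.2 fun i => (hfg i).weakPartial_ae_eq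
  have hdiv : ∀ᵐ x, ∀ i, weakPartial i (fun x => (W x i : ℂ) * f x) x
      = dW i x i • f x + W x i • g i x :=
    ae_all_iff.2 fun i => (hasWeakPartial_component_mul hp₁ hW (hWdW i) (hdW i) hf (hg i)
      (hfg i)).weakPartial_ae_eq
  filter_upwards [hgrad, hdiv] with x hgrad_x hdiv_x
  simp only [source, hgrad_x, hdiv_x, Complex.real_smul]
  push_cast
  ring

lemma isSource_source (hp₁ : ExponentOK n p₁) (hp₂ : ExponentOK n p₂) (hε : 0 < ε)
    (hδ : weightBound n ⊤ + ε < δ) (hδ₁ : weightBound n p₁ + ε < δ₁)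
    (hδ₂ : weightBound n p₂ + ε < δ₂) (hW : MemWLp ⊤ δ W) (hgradW : WeakGradMemWLp p₁ δ₁ W)
    (hV : MemWLp p₂ δ₂ V) (hf : MemH1 (-(n / 2 + ε)) f) :
    IsSource ((n - 1) / 2) (n / 2 + ε) (source W V f) := by
  obtain ⟨hf₂, hgrad⟩ := id hf
  choose g hfg hg using hgrad
  choose dW hWdW hdW using hgradW
  have hdWf (i : Fin n) : IsSource ((n - 1) / 2) (n / 2 + ε) fun x => dW i x i • f x :=
    .smul_of_memH1 hp₁ hε hδ₁ ((hdW i).apply i) hf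
  have hWg (i : Fin n) : IsSource ((n - 1) / 2) (n / 2 + ε) fun x => W x i • g i x :=
    .smul_of_memWLp_top hε hδ (hW.apply i) (hg i)
  have hδ0 : 0 ≤ δ := by linarith [weightBound_nonneg (n := n) (p := ⊤) (by simp)]
  have hWWf : IsSource ((n - 1) / 2) (n / 2 + ε) fun x => ‖W x‖ ^ 2 • f x :=
    .smul_of_memWLp_top hε hδ (hW.norm_sq_top hδ0) hf₂
  have hVf : IsSource ((n - 1) / 2) (n / 2 + ε) fun x => V x • f x :=
    .smul_of_memH1 hp₂ hε hδ₂ hV hf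
  have hdiv := (IsSource.sum Finset.univ fun i _ => (hdWf i).add (hWg i)).const_mul Complex.I
  have hWgrad := (IsSource.sum Finset.univ fun i _ => hWg i).const_mul Complex.I
  exact ((hdiv.add hWgrad).add ((hWWf.add hVf).const_mul (-1))).congr
    (source_ae_eq hp₁.two_lt.le hW hWdW hdW hf₂ hg hfg).symm

lemma lkDefined_and_memH1_lk (hp₁ : ExponentOK n p₁) (hp₂ : ExponentOK n p₂) (hε : 0 < ε)
    (hδ : weightBound n ⊤ + ε < δ) (hδ₁ : weightBound n p₁ + ε < δ₁)
    (hδ₂ : weightBound n p₂ + ε < δ₂) (hW : MemWLp ⊤ δ W) (hgradW : WeakGradMemWLp p₁ δ₁ W)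
    (hV : MemWLp p₂ δ₂ V) {k : ℝ} (hk : k ≠ 0) (hf : MemH1 (-(n / 2 + ε)) f) :
    LkDefined k W V f ∧ MemH1 (-(n / 2 + ε)) (Lk k W V f) := by
  have hsource := isSource_source hp₁ hp₂ hε hδ hδ₁ hδ₂ hW hgradW hV hf
  have hn : (2 : ℝ) ≤ n := by rcases hp₁.dim with rfl | rfl <;> norm_num
  have hα : (0 : ℝ) ≤ (n - 1) / 2 := by linarith
  have hαn : ((n : ℝ) - 1) / 2 + 1 < n := by linarith
  have hασ : ((n : ℝ) - 1) / 2 ≤ n / 2 + ε := by linarith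
  have hσ : (n : ℝ) / 2 < n / 2 + ε := lt_add_of_pos_right _ hε
  obtain ⟨C, hG⟩ := exists_isOutgoingProfile_greenPlus hp₁.dim (abs_pos.2 hk)
  refine ⟨⟨fun i => ?_, fun i => (hf.2 i).imp fun _ h => h.1, ?_⟩,
    hG.memH1_integral hsource hα hαn hασ hσ⟩
  · obtain ⟨dW, hWdW, hdW⟩ := hgradW i
    obtain ⟨g, hfg, hg⟩ := hf.2 i
    exact ⟨_, hasWeakPartial_component_mul hp₁.two_lt.le hW hWdW hdW hf.1 hg hfg⟩
  · exact (hG.isOutgoingKernel hα hαn).ae_integrable hsource hα hασ hσ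

end Source

end MagneticScattering

end

open MagneticScattering in
theorem lemma2p1 (n : ℕ) (p₁ p₂ : ENNReal) (hp₁ : ExponentOK n p₁) (hp₂ : ExponentOK n p₂)
    (δ δ₁ δ₂ : ℝ) (hδ : weightBound n ⊤ < δ) (hδ₁ : weightBound n p₁ < δ₁)
    (hδ₂ : weightBound n p₂ < δ₂)
    (W : E n → E n) (V : E n → ℝ)
    (hW : MemWLp ⊤ δ W) (hgradW : WeakGradMemWLp p₁ δ₁ W) (hV : MemWLp p₂ δ₂ V) :
    ∃ δ₀ : ℝ, 1 / 2 < δ₀ ∧ ∀ k : ℝ, k ≠ 0 →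
      (∀ θ : E n, ‖θ‖ = 1 →
        LkDefined k W V (planeWave k θ) ∧ MemH1 (-δ₀) (Lk k W V (planeWave k θ))) ∧
      (∀ f : E n → ℂ, MemH1 (-δ₀) f → LkDefined k W V f ∧ MemH1 (-δ₀) (Lk k W V f)) := by
  obtain ⟨ε, hε, hlt⟩ := exists_between
    (lt_min (sub_pos.2 hδ) (lt_min (sub_pos.2 hδ₁) (sub_pos.2 hδ₂)))
  simp only [lt_min_iff, lt_sub_iff_add_lt'] at hlt
  obtain ⟨hεδ, hεδ₁, hεδ₂⟩ := hlt
  have hn : (2 : ℝ) ≤ n := by rcases hp₁.dim with rfl | rfl <;> norm_num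
  have hmap (k : ℝ) (hk : k ≠ 0) (f : E n → ℂ) (hf : MemH1 (-(n / 2 + ε)) f) :
      LkDefined k W V f ∧ MemH1 (-(n / 2 + ε)) (Lk k W V f) :=
    lkDefined_and_memH1_lk hp₁ hp₂ hε hεδ hεδ₁ hεδ₂ hW hgradW hV hk hf
  refine ⟨n / 2 + ε, by linarith, fun k hk => ⟨fun θ _ => hmap k hk _ ?_, hmap k hk⟩⟩
  exact memH1_planeWave (lt_add_of_pos_right _ hε) k θ
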